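/- Let $K$ be a field of characteristic $0$, $n\ge 1$, and let $V=\bigoplus_{\alpha\in\mathbb{Z}^n}V^\alpha$ be a $\mathbb{Z}^n$-graded vector space over $K$. We write $\langle\alpha,\beta\rangle=\sum_i\alpha_i\beta_i$ for $\alpha,\beta\in\mathbb{Z}^n$, put $e_1=(1,0,\dots,0)$, and denote the degree of a homogeneous vector or map by the same symbol. For $B\in\mathbb{Z}^n$ and $b\ge 0$ let $M^{(B,b)}(V)$ be the space of $(b+1)$-linear maps $V^{\times(b+1)}\to V$ of weight $B$; put $M^{(B,-1)}(V)=V^B$ and $M(V)=\bigoplus_{B\in\mathbb{Z}^n,\,b\ge-1}M^{(B,b)}(V)$. *Stem bracket.* Let $W=\,\downarrow\! V$ be the space $V$ with the grading $W^\alpha=V^{\alpha+e_1}$, and $T(W)=\bigoplus_{p\ge1}W^{\otimes p}$. Tensor products of graded maps follow the Koszul rule $(f\otimes g)(v\otimes w)=(-1)^{\langle g,v\rangle}f(v)\otimes g(w)$. For $A\in M^{(A,a)}(V)$, $a\ge0$, let $q=(-1)^{a(a+1)/2}\downarrow\circ A\circ\uparrow^{\otimes(a+1)}$ and let $\phi(A)=Q^A$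 be the coderivation of $T(W)$, of weight $Q=A+ae_1$, given on homogeneous vectors by $$Q^A(w_1\otimes\cdots\otimes w_p)=\sum\varepsilon(I;J)(-1)^{\langle Q,W_I\rangle}\,W_I\otimes q(W_J\otimes w_{k_1})\otimes W_{K\setminus k_1},$$ where the sum runs over the partitions $I\cup J\cup K=\{1,\dots,p\}$ with $|J|=a$, $K$ nonempty with least element $k_1$, and all elements of $I$ and $J$ smaller than $k_1$; $W_I$ is the tensor product of the $w_i$, $i\in I$, in increasing order (in exponents, the sum of their degrees), and $\varepsilon(I;J)$ is the Koszul sign of the reordering of $(I;J)$ into $I\cup J$. Then, for $A\in M^{(A,a)}(V)$, $B\in M^{(B,b)}(V)$, $a,b\ge0$, $$[A,B]^\otimes=(-1)^{1+\langle ae_1,\,be_1+B\rangle}\,\phi^{-1}\big(Q^AQ^B-(-1)^{\langle A+ae_1,\,B+be_1\rangle}Q^BQ^A\big),$$ where $\phi^{-1}(R)=\,\uparrow\circ\,(\mathrm{pr}_W\circ R)|_{W^{\otimes(a+b+1)}}\circ\downarrow^{\otimes(a+b+1)}$. **Proposition.** Let $\pi=\{-,-\}$ be a graded Loday bracket on $V$,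 i.e. a bilinear map of weight $0$ with $\{x,\{y,z\}\}=\{\{x,y\},z\}+(-1)^{\langle x,y\rangle}\{y,\{x,z\}\}$ for all homogeneous $x,y,z$. There is a linear operator $\partial_\pi:M(V)\to M(V)$ which on $M^{(B,b)}(V)$, $b\ge0$, is $[\pi,-]^\otimes$, which on $V=M^{-1}(V)$ is given by $(\partial_\pi v)(w)=\{v,w\}$, and which maps $M^{(B,b)}(V)$ into $M^{(B,b+1)}(V)$. It has the following properties. 1. For all $B\in M^{(B,b)}(V)$, $b\ge-1$, and all homogeneous $v_1,\dots,v_{b+2}\in V$, $$\begin{aligned}(\partial_\pi B)(v_1,\dots,v_{b+2})={}&(-1)^{b+1}\{B(v_1,\dots,v_{b+1}),v_{b+2}\}\\&-\sum_{i=1}^{b+1}(-1)^{i-1}(-1)^{\langle B+v_1+\dots+v_{i-1},\,v_i\rangle}\{v_i,B(v_1,\dots,\widehat{v_i},\dots,v_{b+2})\}\\&+\sum_{i=1}^{b+1}\sum_{j=1}^{i}(-1)^{j+1}(-1)^{\langle v_j,\,v_{j+1}+\dots+v_i\rangle}B(v_1,\dots,\widehat{v_j},\dots,v_i,\{v_j,v_{i+1}\},v_{i+2},\dots,v_{b+2}).\end{aligned}$$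 2. $\partial_\pi\circ\partial_\pi=0$ on $M(V)$. 3. (Nongraded case.) If $V$ is concentrated in degree $0$, then $\partial_\pi$ is the Loday coboundary operator with adjoint coefficients, up to the global sign convention: for every $p$-linear $f$, $p\ge0$, one has $\partial_\pi f=-\delta f$, where $$\begin{aligned}(\delta f)(v_1,\dots,v_{p+1})={}&\sum_{i=1}^{p}(-1)^{i+1}\{v_i,f(\dots,\widehat{v_i},\dots)\}+(-1)^{p+1}\{f(v_1,\dots,v_p),v_{p+1}\}\\&+\sum_{1\le i<j\le p+1}(-1)^i f(v_1,\dots,\widehat{v_i},\dots,v_{j-1},\{v_i,v_j\},v_{j+1},\dots,v_{p+1}).\end{aligned}$$ 4. (Antisymmetric case.) If $\pi$ is graded skew-symmetric, then $\partial_\pi$ maps graded skew-symmetric maps to graded skew-symmetric maps, and on a graded skew-symmetric $p$-linear map $f$ of weight $B$, $p\ge0$, it is the opposite $-d$ of the graded Chevalley–Eilenberg coboundary, which is given for homogeneous $v_1,\dots,v_{p+1}$ by $$\begin{aligned}(df)(v_1,\dots,v_{p+1})={}&\sum_{i=1}^{p+1}(-1)^{i+1}(-1)^{\langle v_i,\,B+v_1+\dots+v_{i-1}\rangle}\{v_i,f(\dots,\widehat{v_i},\dots)\}\\&+\sum_{1\le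 i<j\le p+1}(-1)^{i+j}(-1)^{\langle v_i,\,v_1+\dots+v_{i-1}\rangle+\langle v_j,\,v_1+\dots\widehat{v_i}\dots+v_{j-1}\rangle}f(\{v_i,v_j\},v_1,\dots,\widehat{v_i},\dots,\widehat{v_j},\dots,v_{p+1}).\end{aligned}$$ Here a multilinear map is graded skew-symmetric if exchanging two consecutive homogeneous arguments $x,y$ multiplies its value by $-(-1)^{\langle x,y\rangle}$. -/

import Mathlib

open scoped DirectSum TensorProduct

noncomputable section

namespace GradedLoday

/-- The group `ℤⁿ` of degrees; `⟨α, β⟩` is the dot product `α ⬝ᵥ β`. -/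
abbrev Deg (n : ℕ) : Type := Fin n → ℤ

/-- The degree `e₁ = (1, 0, …, 0)`. -/
def e₁ (n : ℕ) [NeZero n] : Deg n := Pi.single 0 1

/-- The sign `(-1)^k`, for an integer `k`. -/
def sgn (k : ℤ) : ℤ := (Int.negOnePow k : ℤˣ)

section Signs

variable {K V X : Type*} [Field K] [AddCommGroup V] [Module K V] [AddCommGroup X] [Module K X]
  {n p : ℕ} (𝒱 : Deg n → Submodule K V) [DirectSum.Decomposition 𝒱]

/-- For a graded space `V = ⨁ 𝒱 α`, the multilinear map which on homogeneous vectors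
`v i ∈ 𝒱 (α i)` takes the value `ε α • f v` (see `signTwist_apply`). -/
def signTwist (ε : (Fin p → Deg n) → ℤ) (f : MultilinearMap K (fun _ : Fin p => V) X) :
    MultilinearMap K (fun _ : Fin p => V) X :=
  (MultilinearMap.fromDFinsuppEquiv (fun _ : Fin p => Deg n) K
    (fun α => ε α • f.compLinearMap (fun i => (𝒱 (α i)).subtype))).compLinearMap
    (fun _ => (DirectSum.decomposeLinearEquiv 𝒱).toLinearMap)

theorem signTwist_apply (ε : (Fin p → Deg n) → ℤ) (f : MultilinearMap K (fun _ : Fin p => V) X)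
    (α : Fin p → Deg n) (v : Fin p → V) (hv : ∀ i, v i ∈ 𝒱 (α i)) :
    signTwist 𝒱 ε f v = ε α • f v := by
  have h : (fun i => DirectSum.decompose 𝒱 (v i)) =
      fun i => DFinsupp.single (α i) (⟨v i, hv i⟩ : 𝒱 (α i)) := by
    funext i
    exact DirectSum.decompose_of_mem 𝒱 (hv i)
  simp only [signTwist, MultilinearMap.compLinearMap_apply, LinearEquiv.coe_coe,
    DirectSum.decomposeLinearEquiv_apply]
  rw [h, MultilinearMap.fromDFinsuppEquiv_single]
  simp

/-- The space of `p`-linear maps `V × ⋯ × V → V` of weight `B`.  With `p = b + 1` this is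
`M^{(B,b)}(V)`; a `0`-linear map is a vector, so `p = 0` gives `M^{(B,-1)}(V) = V^B`. -/
def weightMaps (𝒱 : Deg n → Submodule K V) (B : Deg n) (p : ℕ) :
    Submodule K (MultilinearMap K (fun _ : Fin p => V) V) where
  carrier := {f | ∀ (α : Fin p → Deg n) (v : Fin p → V), (∀ i, v i ∈ 𝒱 (α i)) →
    f v ∈ 𝒱 (B + ∑ i, α i)}
  add_mem' hf hg α v hv := (𝒱 _).add_mem (hf α v hv) (hg α v hv)
  zero_mem' _ _ _ := (𝒱 _).zero_mem
  smul_mem' c _ hf α v hv := (𝒱 _).smul_mem c (hf α v hv)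

/-- `M(V) = ⨁ M^{(B,b)}(V)` over `B ∈ ℤⁿ` and `b ≥ -1`; the summand with index `(B, p)` is
`M^{(B,p-1)}(V)`. -/
abbrev Cochains (𝒱 : Deg n → Submodule K V) : Type _ :=
  ⨁ x : Deg n × ℕ, weightMaps 𝒱 x.1 x.2

/-- A `ℤⁿ`-graded Loday structure: a bilinear bracket of weight `0` that satisfies the graded
Jacobi identity `{a,{b,c}} = {{a,b},c} + (-1)^⟨a,b⟩ {b,{a,c}}` on homogeneous vectors. -/
def IsLodayBracket (𝒱 : Deg n → Submodule K V) (π : MultilinearMap K (fun _ : Fin 2 => V) V) :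
    Prop :=
  π ∈ weightMaps 𝒱 0 2 ∧
    ∀ (α β γ : Deg n) (a b c : V), a ∈ 𝒱 α → b ∈ 𝒱 β → c ∈ 𝒱 γ →
      π ![a, π ![b, c]] = π ![π ![a, b], c] + sgn (α ⬝ᵥ β) • π ![b, π ![a, c]]

/-- Graded skew-symmetry of a multilinear map: exchanging two consecutive homogeneous arguments
`v i`, `v (i+1)` multiplies the value by `-(-1)^⟨v i, v (i+1)⟩`. -/
def IsGradedSkew (𝒱 : Deg n → Submodule K V) {p : ℕ}
    (f : MultilinearMap K (fun _ : Fin p => V) X) : Prop :=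
  ∀ (i j : Fin p), j.val = i.val + 1 → ∀ (α : Fin p → Deg n) (v : Fin p → V),
    (∀ l, v l ∈ 𝒱 (α l)) → f (v ∘ Equiv.swap i j) = -(sgn (α i ⬝ᵥ α j) • f v)

end Signs

/-! ### Coderivations of the tensor coalgebra -/

section Coderivation

variable {K W : Type*} [Field K] [AddCommGroup W] [Module K W] {n p a : ℕ}

/-- For `S = J ∪ {k₁}` with `J < k₁`, the index `k₁`. -/
def top (S : {S : Finset (Fin p) // S.card = a + 1}) : Fin p :=
  S.1.orderEmbOfFin S.2 (Fin.last a)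

/-- For `S = J ∪ {k₁}`, the indices `I` in front of `k₁` that are not in `J`. -/
def before (S : {S : Finset (Fin p) // S.card = a + 1}) : Finset (Fin p) :=
  Finset.univ.filter (fun i => i < top S ∧ i ∉ S.1)

/-- For `S = J ∪ {k₁}`, the indices `K \ k₁ = {k₁ + 1, …, p}`. -/
def after (S : {S : Finset (Fin p) // S.card = a + 1}) : Finset (Fin p) :=
  Finset.univ.filter (fun i => top S < i)

/-- The tensor `v_{i₁} ⊗ ⋯ ⊗ v_{i_k}` for `I = {i₁ < ⋯ < i_k}`. -/
def word (K : Type*) {W : Type*} [Field K] [AddCommGroup W] [Module K W] {p : ℕ}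
    (v : Fin p → W) (I : Finset (Fin p)) : TensorAlgebra K W :=
  ((I.sort (· ≤ ·)).map (fun i => TensorAlgebra.ι K (v i))).prod

theorem word_update_of_notMem (v : Fin p → W) {I : Finset (Fin p)} {j : Fin p} (hj : j ∉ I)
    (x : W) : word K (Function.update v j x) I = word K v I := by
  unfold word
  congr 1
  refine List.map_congr_left fun i hi => ?_
  rw [Function.update_of_ne]
  rintro rfl
  exact hj ((Finset.mem_sort _).1 hi)

theorem listProd_update (v : Fin p → W) (j : Fin p) :
    ∀ l : List (Fin p), l.Nodup → j ∈ l → ∃ A B : TensorAlgebra K W, ∀ x : W,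
      (l.map (fun i => TensorAlgebra.ι K (Function.update v j x i))).prod =
        A * TensorAlgebra.ι K x * B
  | [], _, h => by simp at h
  | i :: l, hl, h => by
    rw [List.nodup_cons] at hl
    by_cases hij : i = j
    · subst hij
      refine ⟨1, (l.map (fun i => TensorAlgebra.ι K (v i))).prod, fun x => ?_⟩
      have : l.map (fun k => TensorAlgebra.ι K (Function.update v i x k)) =
          l.map (fun k => TensorAlgebra.ι K (v k)) := by
        refine List.map_congr_left fun k hk => ?_
        rw [Function.update_of_ne]
        rintro rfl
        exact hl.1 hk
      simp [this]
    · have hjl : j ∈ l := by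
        rcases List.mem_cons.1 h with h | h
        · exact absurd h.symm hij
        · exact h
      obtain ⟨A, B, hAB⟩ := listProd_update v j l hl.2 hjl
      refine ⟨TensorAlgebra.ι K (v i) * A, B, fun x => ?_⟩
      rw [List.map_cons, List.prod_cons, hAB, Function.update_of_ne hij]
      simp [mul_assoc]

theorem word_update_of_mem (v : Fin p → W) {I : Finset (Fin p)} {j : Fin p} (hj : j ∈ I) :
    ∃ A B : TensorAlgebra K W, ∀ x : W,
      word K (Function.update v j x) I = A * TensorAlgebra.ι K x * B :=
  listProd_update v j _ (Finset.sort_nodup _ _) ((Finset.mem_sort _).2 hj)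

/-- `V_I ⊗ q(V_J ⊗ v_{k₁}) ⊗ V_{K \ k₁}`, without sign, for `S = J ∪ {k₁}`. -/
def insertTerm (q : MultilinearMap K (fun _ : Fin (a + 1) => W) W)
    (S : {S : Finset (Fin p) // S.card = a + 1}) (v : Fin p → W) : TensorAlgebra K W :=
  word K v (before S) * TensorAlgebra.ι K (q (v ∘ S.1.orderEmbOfFin S.2)) * word K v (after S)

theorem insertTerm_update (q : MultilinearMap K (fun _ : Fin (a + 1) => W) W)
    (S : {S : Finset (Fin p) // S.card = a + 1}) (v : Fin p → W) (j : Fin p) :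
    ∃ L : W →ₗ[K] TensorAlgebra K W, ∀ x, insertTerm q S (Function.update v j x) = L x := by
  have htop : top S ∈ S.1 := Finset.orderEmbOfFin_mem _ _ _
  by_cases hS : j ∈ S.1
  · obtain ⟨s, rfl⟩ : ∃ s, S.1.orderEmbOfFin S.2 s = j := by
      have : j ∈ Set.range (S.1.orderEmbOfFin S.2) := by
        rw [Finset.range_orderEmbOfFin]; exact hS
      exact this
    have hle : S.1.orderEmbOfFin S.2 s ≤ top S :=
      (S.1.orderEmbOfFin S.2).monotone (Fin.le_last s)
    refine ⟨(LinearMap.mulRight K (word K v (after S))) ∘ₗ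
      (LinearMap.mulLeft K (word K v (before S))) ∘ₗ TensorAlgebra.ι K ∘ₗ
      q.toLinearMap (v ∘ S.1.orderEmbOfFin S.2) s, fun x => ?_⟩
    have h1 : S.1.orderEmbOfFin S.2 s ∉ before S := by simp [before]
    have h2 : S.1.orderEmbOfFin S.2 s ∉ after S := by simpa [after] using hle
    rw [insertTerm, word_update_of_notMem v h1, word_update_of_notMem v h2,
      Function.update_comp_eq_of_injective _ (S.1.orderEmbOfFin S.2).injective]
    rfl
  · have hq : ∀ x, Function.update v j x ∘ S.1.orderEmbOfFin S.2 =
        v ∘ S.1.orderEmbOfFin S.2 := fun x => by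
      refine Function.update_comp_eq_of_forall_ne _ _ fun s => ?_
      rintro rfl
      exact hS (Finset.orderEmbOfFin_mem _ _ _)
    have hne : j ≠ top S := fun h => hS (h ▸ htop)
    rcases lt_or_gt_of_ne hne with h | h
    · have h1 : j ∈ before S := by simp [before, h, hS]
      have h2 : j ∉ after S := by simpa [after] using h.le
      obtain ⟨A, B, hAB⟩ := word_update_of_mem (K := K) v h1
      refine ⟨(LinearMap.mulRight K (word K v (after S))) ∘ₗ
        (LinearMap.mulRight K (TensorAlgebra.ι K (q (v ∘ S.1.orderEmbOfFin S.2)))) ∘ₗ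
        (LinearMap.mulRight K B) ∘ₗ (LinearMap.mulLeft K A) ∘ₗ TensorAlgebra.ι K, fun x => ?_⟩
      rw [insertTerm, word_update_of_notMem v h2, hAB, hq]
      rfl
    · have h1 : j ∉ before S := by simp [before, h.le]
      have h2 : j ∈ after S := by simpa [after] using h
      obtain ⟨A, B, hAB⟩ := word_update_of_mem (K := K) v h2
      refine ⟨(LinearMap.mulLeft K (word K v (before S) *
        TensorAlgebra.ι K (q (v ∘ S.1.orderEmbOfFin S.2)))) ∘ₗ
        (LinearMap.mulRight K B) ∘ₗ (LinearMap.mulLeft K A) ∘ₗ TensorAlgebra.ι K, fun x => ?_⟩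
      rw [insertTerm, word_update_of_notMem v h1, hAB, hq]
      rfl

/-- `insertTerm` as a multilinear map. -/
def insertMap (q : MultilinearMap K (fun _ : Fin (a + 1) => W) W)
    (S : {S : Finset (Fin p) // S.card = a + 1}) :
    MultilinearMap K (fun _ : Fin p => W) (TensorAlgebra K W) :=
  MultilinearMap.mk' (insertTerm q S)
    (fun v j x y => by
      obtain ⟨L, hL⟩ := insertTerm_update q S v j
      simp only [hL, map_add])
    (fun v j c x => by
      obtain ⟨L, hL⟩ := insertTerm_update q S v j
      simp only [hL, map_smul])

/-- The sign `ε(I;J) (-1)^⟨Q, V_I⟩` for `S = J ∪ {k₁}` and arguments of degrees `α`: the Koszul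
sign `ε(I;J)` collects `(-1)^⟨v_i, v_j⟩` over all `i ∈ I`, `j ∈ J` with `j < i`. -/
def codSign (Q : Deg n) (S : {S : Finset (Fin p) // S.card = a + 1}) (α : Fin p → Deg n) : ℤ :=
  sgn ((∑ i ∈ before S, ∑ j ∈ (S.1.erase (top S)).filter (fun j => j < i), α i ⬝ᵥ α j) +
    ∑ i ∈ before S, Q ⬝ᵥ α i)

variable (𝒲 : Deg n → Submodule K W) [DirectSum.Decomposition 𝒲]

/-- The weight `Q` coderivation of the graded dual Leibniz coalgebra `T(W) = ⨁_{p ≥ 1} W^{⊗p}`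
whose only nonzero corestriction map is the weight `Q` map `q : W^{⊗(a+1)} → W`:
`v₁ ⊗ ⋯ ⊗ v_p ↦ ∑ ε(I;J) (-1)^⟨Q,V_I⟩ V_I ⊗ q(V_J ⊗ v_{k₁}) ⊗ V_{K \ k₁}`, the sum being over
the partitions `I ∪ J ∪ K = {1, …, p}` with `I, J < K` (`K` nonempty with least element `k₁`) and
`|J| = a`; such a partition is determined by the set `S = J ∪ {k₁}`, whose greatest element
is `k₁`.  The operator is defined on the full tensor algebra, and kills constants. -/
def coder (Q : Deg n) (q : MultilinearMap K (fun _ : Fin (a + 1) => W) W) :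
    TensorAlgebra K W →ₗ[K] TensorAlgebra K W :=
  (DirectSum.toModule K ℕ (TensorAlgebra K W) (fun p => PiTensorProduct.lift
    (∑ S : {S : Finset (Fin p) // S.card = a + 1},
      signTwist 𝒲 (codSign Q S) (insertMap q S)))) ∘ₗ
    (TensorAlgebra.equivDirectSum (R := K) (M := W)).toLinearMap

theorem coder_tprod (Q : Deg n) (q : MultilinearMap K (fun _ : Fin (a + 1) => W) W)
    (α : Fin p → Deg n) (v : Fin p → W) (hv : ∀ i, v i ∈ 𝒲 (α i)) :
    coder 𝒲 Q q (TensorAlgebra.tprod K W p v) =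
      ∑ S : {S : Finset (Fin p) // S.card = a + 1}, codSign Q S α •
        (word K v (before S) * TensorAlgebra.ι K (q (v ∘ S.1.orderEmbOfFin S.2)) *
          word K v (after S)) := by
  have h : TensorAlgebra.equivDirectSum (R := K) (TensorAlgebra.tprod K W p v) =
      DirectSum.lof K ℕ (fun p => ⨂[K]^p W) p (PiTensorProduct.tprod K v) :=
    TensorAlgebra.toDirectSum_tensorPower_tprod v
  have h' : coder 𝒲 Q q (TensorAlgebra.tprod K W p v) =
      (DirectSum.toModule K ℕ (TensorAlgebra K W) (fun p => PiTensorProduct.lift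
        (∑ S : {S : Finset (Fin p) // S.card = a + 1},
          signTwist 𝒲 (codSign Q S) (insertMap q S))))
        (TensorAlgebra.equivDirectSum (R := K) (TensorAlgebra.tprod K W p v)) := rfl
  rw [h', h, DirectSum.toModule_lof, PiTensorProduct.lift.tprod, _root_.sum_apply]
  refine Finset.sum_congr rfl fun S _ => ?_
  rw [signTwist_apply 𝒲 _ _ α v hv]
  rfl

end Coderivation

/-! ### Desuspension and the stem bracket -/

section Stem

variable {K V : Type*} [Field K] [AddCommGroup V] [Module K V] {n : ℕ} [NeZero n]
  (𝒱 : Deg n → Submodule K V)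

/-- The grading of the desuspension `↓V`: the same space with `(↓V)^α = V^{α + e₁}`. -/
def desusp (α : Deg n) : Submodule K V := 𝒱 (α + e₁ n)

instance desuspDecomposition [DirectSum.Decomposition 𝒱] :
    DirectSum.Decomposition (desusp 𝒱) :=
  DirectSum.IsInternal.chooseDecomposition _ <| by
    have h := (DirectSum.isInternal_submodule_iff_iSupIndep_and_iSup_eq_top 𝒱).1
      (DirectSum.Decomposition.isInternal 𝒱)
    refine (DirectSum.isInternal_submodule_iff_iSupIndep_and_iSup_eq_top _).2 ⟨?_, ?_⟩
    · exact h.1.comp (add_left_injective (e₁ n))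
    · rw [← h.2]
      exact (Equiv.addRight (e₁ n)).iSup_comp (g := 𝒱)

/-- The exponent `∑ₛ ⟨(p - s) e₁, vₛ⟩` (`s = 1, …, p`) that `↓^{⊗p}` and `↑^{⊗p}` produce on
homogeneous vectors of degrees `α`. -/
def suspExp {p : ℕ} (α : Fin p → Deg n) : ℤ :=
  ∑ s : Fin p, ((p : ℤ) - 1 - (s.val : ℤ)) * (e₁ n ⬝ᵥ α s)

variable [DirectSum.Decomposition 𝒱]

/-- The corestriction map `Q^f_{a+1} = (-1)^{a(a+1)/2} ↓ ∘ f ∘ ↑^{⊗(a+1)}` on `↓V`. -/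
def corestr {a : ℕ} (f : MultilinearMap K (fun _ : Fin (a + 1) => V) V) :
    MultilinearMap K (fun _ : Fin (a + 1) => V) V :=
  sgn ((a * (a + 1) / 2 : ℕ) : ℤ) • signTwist (desusp 𝒱) (fun α => sgn (suspExp α)) f

/-- `φ_{(A,a)}(f)`: the coderivation `Q^f` of `T(↓V)`, of weight `A + a e₁`, associated with a map
`f ∈ M^{(A,a)}(V)`. -/
def phi (A : Deg n) {a : ℕ} (f : MultilinearMap K (fun _ : Fin (a + 1) => V) V) :
    TensorAlgebra K V →ₗ[K] TensorAlgebra K V :=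
  coder (desusp 𝒱) (A + (a : ℤ) • e₁ n) (corestr 𝒱 f)

/-- The inverse of `φ` on coderivations of `T(↓V)` whose only nonzero corestriction map is the
one on `(↓V)^{⊗(m+1)}`: the map `↑ ∘ R_{m+1} ∘ ↓^{⊗(m+1)}`, where `R_{m+1} = pr ∘ R` on
`(↓V)^{⊗(m+1)}`. -/
def phiInv (m : ℕ) (R : TensorAlgebra K V →ₗ[K] TensorAlgebra K V) :
    MultilinearMap K (fun _ : Fin (m + 1) => V) V :=
  signTwist 𝒱 (fun α => sgn (suspExp α))
    ((TensorAlgebra.ιInv ∘ₗ R).compMultilinearMap (TensorAlgebra.tprod K V (m + 1)))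

/-- The stem bracket of `f ∈ M^{(A,a)}(V)` and `g ∈ M^{(B,b)}(V)`, `a, b ≥ 0`:
`[f,g]^⊗ = (-1)^{1 + ⟨a e₁, b e₁ + B⟩} φ⁻¹ [φ f, φ g]`, where the bracket on the right is the graded
commutator of coderivations of `T(↓V)`. -/
def stemBracket (A B : Deg n) {a b : ℕ} (f : MultilinearMap K (fun _ : Fin (a + 1) => V) V)
    (g : MultilinearMap K (fun _ : Fin (b + 1) => V) V) :
    MultilinearMap K (fun _ : Fin (b + a + 1) => V) V :=
  sgn (1 + ((a : ℤ) • e₁ n) ⬝ᵥ ((b : ℤ) • e₁ n + B)) •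
    phiInv 𝒱 (b + a) (phi 𝒱 A f ∘ₗ phi 𝒱 B g -
      sgn ((A + (a : ℤ) • e₁ n) ⬝ᵥ (B + (b : ℤ) • e₁ n)) • (phi 𝒱 B g ∘ₗ phi 𝒱 A f))

end Stem

/-! ### The classical coboundary operators -/

section Classical

variable {K V : Type*} [Field K] [AddCommGroup V] [Module K V] {n : ℕ}

/-- The Loday (Leibniz) coboundary, with adjoint coefficients, of a `p`-cochain `f` of a nongraded
(left) Loday algebra with bracket `π`, evaluated at `v = (v₁, …, v_{p+1})`:
`∑_{i ≤ p} (-1)^{i+1} {vᵢ, f(…, v̂ᵢ, …)} + (-1)^{p+1} {f(v₁, …, v_p), v_{p+1}}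
  + ∑_{i < j} (-1)^i f(v₁, …, v̂ᵢ, …, {vᵢ, vⱼ}, …, v_{p+1})`, with `{vᵢ, vⱼ}` at the place of `vⱼ`.
(In the code the indices start from `0`.) -/
def lodayCoboundary (π : MultilinearMap K (fun _ : Fin 2 => V) V) {p : ℕ}
    (f : MultilinearMap K (fun _ : Fin p => V) V) (v : Fin (p + 1) → V) : V :=
  (∑ i : Fin p, sgn (i.val : ℤ) • π ![v i.castSucc, f (i.castSucc.removeNth v)]) +
    sgn ((p : ℤ) + 1) • π ![f (Fin.init v), v (Fin.last p)] +
    ∑ i : Fin (p + 1), ∑ j ∈ Finset.Ioi i, sgn ((i.val : ℤ) + 1) •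
      f (i.removeNth (Function.update v j (π ![v i, v j])))

/-- The part of the graded Chevalley–Eilenberg coboundary of a `p`-cochain of degree-`α` arguments
that involves the bracket inside the cochain:
`∑_{i < j} (-1)^{i+j} (-1)^{⟨vᵢ, v₁ + ⋯ + v_{i-1}⟩ + ⟨vⱼ, v₁ + ⋯ v̂ᵢ ⋯ + v_{j-1}⟩}
  f({vᵢ, vⱼ}, v₁, …, v̂ᵢ, …, v̂ⱼ, …, v_{p+1})`; it is zero for `p = 0`.
(In the code the indices start from `0`, and `j` is replaced by `j + 1`, so that `i ≤ j`.) -/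
def ceBracketPart (π : MultilinearMap K (fun _ : Fin 2 => V) V) :
    {p : ℕ} → MultilinearMap K (fun _ : Fin p => V) V → (Fin (p + 1) → Deg n) →
      (Fin (p + 1) → V) → V
  | 0, _, _, _ => 0
  | m + 1, f, α, v => ∑ j : Fin (m + 1), ∑ i ∈ Finset.Iic j,
      sgn ((i.val : ℤ) + j.val + 1 +
        α i.castSucc ⬝ᵥ (∑ l ∈ Finset.Iio i.castSucc, α l) +
        α j.succ ⬝ᵥ (∑ l ∈ (Finset.Iio j.succ).erase i.castSucc, α l)) •
      f (Fin.cons (π ![v i.castSucc, v j.succ]) (i.removeNth (j.succ.removeNth v)))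

/-- The graded Chevalley–Eilenberg coboundary, with adjoint coefficients, of a `p`-cochain `f` of
weight `B` of a graded Lie algebra with bracket `π`, evaluated at homogeneous vectors
`v = (v₁, …, v_{p+1})` of degrees `α`:
`∑ᵢ (-1)^{i+1} (-1)^⟨vᵢ, B + v₁ + ⋯ + v_{i-1}⟩ {vᵢ, f(…, v̂ᵢ, …)}` plus `ceBracketPart`. -/
def ceCoboundary (π : MultilinearMap K (fun _ : Fin 2 => V) V) (B : Deg n) {p : ℕ}
    (f : MultilinearMap K (fun _ : Fin p => V) V) (α : Fin (p + 1) → Deg n)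
    (v : Fin (p + 1) → V) : V :=
  (∑ i : Fin (p + 1), sgn ((i.val : ℤ) + α i ⬝ᵥ (B + ∑ l ∈ Finset.Iio i, α l)) •
      π ![v i, f (i.removeNth v)]) +
    ceBracketPart π f α v

end Classical

end GradedLoday

end

open scoped DirectSum TensorProduct

noncomputable section

namespace GradedLoday

/-! ### Signs as functions of an exponent modulo 2 -/

section SignRules

/-! The argument is a Cartan calculus for Loday cochains. For homogeneous `x`, let i_x be insertion
of `x` as first argument (`contract`), and let L_x (`lieDer`) be the action of `x` on a cochain:
`{x, -}` on the value, with a degree sign, minus `{x, -}` on each argument. An operator d (`cobd`)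
is defined by recursion on the arity: a vector v goes to `{v, -}`, and in positive arity i_x d =
-L_x - d i_x. The Jacobi identity gives the commutator of two Lie derivatives (`lieDer_comm`). With
the commutation of L and i (`contract_lieDer`), induction yields L_x d = d L_x (`lieDer_cobd`). Then
i_x d d = -L_x d + d L_x + d d i_x, so d d = 0 by induction (`cobd_cobd`), without manipulating
multiple sums.

The explicit formula obeys the same recursion (`explicitCobd_cons`), hence equals d. The stem
bracket also equals it (`stemBracket_apply`): on b + 2 arguments, followed by the projection to W,
the composite of the coderivations of π and f in one order only sees index sets that omit one index,
and in the other order only index sets with two elements. These are the three families of terms in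
the formula. What remains is a comparison of signs, made modulo 2 and argument by argument
(`parity_last`, `parity_remove`, `parity_insert`).

A multilinear map is determined by its values on homogeneous vectors (`toHCochain_injective`), so
all properties of d pass to the operator built from the stem bracket. The nongraded case is a
reindexing of the formula. In the skew case, applying Cartan's formula twice shows that i_y i_x d f
changes by the right sign when `x` and `y` are exchanged (`hSkew_cobd`); moving the inner bracket to
the front turns the explicit formula into the Chevalley–Eilenberg one (`ce_sign`). -/

theorem sgn_add (a b : ℤ) : sgn (a + b) = sgn a * sgn b := by
  simp [sgn, Int.negOnePow_add]

@[simp] theorem sgn_zero : sgn 0 = 1 := by simp [sgn]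

@[simp] theorem sgn_one : sgn 1 = -1 := by simp [sgn]

theorem sgn_eq_or (a : ℤ) : sgn a = 1 ∨ sgn a = -1 := by
  rcases Int.units_eq_one_or (Int.negOnePow a) with h | h <;> simp [sgn, h]

@[simp] theorem sgn_mul_self (a : ℤ) : sgn a * sgn a = 1 := by
  rcases sgn_eq_or a with h | h <;> simp [h]

/-- This moves sign identities into `ZMod 2`, where they become linear identities modulo multiples
of 2. -/
theorem sgn_congr {a b : ℤ} (h : (a : ZMod 2) = b) : sgn a = sgn b := by
  have h2 : Even (a - b) := by
    rw [even_iff_two_dvd]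
    have := (ZMod.intCast_eq_intCast_iff_dvd_sub b a 2).1 h.symm
    exact_mod_cast this
  unfold sgn
  rw [(Int.negOnePow_eq_iff a b).2 h2]

theorem sgn_dotProduct_add_left {n : ℕ} (α β γ : Deg n) :
    sgn ((α + β) ⬝ᵥ γ) = sgn (α ⬝ᵥ γ) * sgn (β ⬝ᵥ γ) := by
  rw [add_dotProduct, sgn_add]

theorem sgn_dotProduct_add_right {n : ℕ} (α β γ : Deg n) :
    sgn (γ ⬝ᵥ (α + β)) = sgn (γ ⬝ᵥ α) * sgn (γ ⬝ᵥ β) := by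
  rw [dotProduct_add, sgn_add]

end SignRules

/-! ### Cartan calculus and d² = 0 on homogeneous arguments -/

section Complex

variable {K V : Type*} [Field K] [AddCommGroup V] [Module K V] {n : ℕ}

/-- A homogeneous vector of a graded space, together with a degree. -/
@[ext] structure HVec (𝒱 : Deg n → Submodule K V) where
  deg : Deg n
  val : V
  mem : val ∈ 𝒱 deg

/-- Cochains, as functions on tuples of homogeneous vectors. -/
abbrev HCochain (𝒱 : Deg n → Submodule K V) (p : ℕ) : Type _ := (Fin p → HVec 𝒱) → V

variable {𝒱 : Deg n → Submodule K V} {π : MultilinearMap K (fun _ : Fin 2 => V) V}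

theorem IsLodayBracket.bracket_mem (hπ : IsLodayBracket 𝒱 π) {α β : Deg n} {x y : V}
    (hx : x ∈ 𝒱 α) (hy : y ∈ 𝒱 β) : π ![x, y] ∈ 𝒱 (α + β) := by
  have := hπ.1 ![α, β] ![x, y] (by intro i; fin_cases i <;> simpa)
  simpa using this

/-- The bracket of homogeneous vectors. -/
def HVec.br (hπ : IsLodayBracket 𝒱 π) (x y : HVec 𝒱) : HVec 𝒱 :=
  ⟨x.deg + y.deg, π ![x.val, y.val], hπ.bracket_mem x.mem y.mem⟩

theorem update_pair_one {X : Type*} (x y z : X) : Function.update ![x, y] 1 z = ![x, z] := by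
  funext i; fin_cases i <;> simp

theorem update_pair_zero {X : Type*} (x y z : X) : Function.update ![x, y] 0 z = ![z, y] := by
  funext i; fin_cases i <;> simp

/-- The map `y ↦ {x, y}`. -/
def adMap (π : MultilinearMap K (fun _ : Fin 2 => V) V) (x : V) : V →ₗ[K] V where
  toFun y := π ![x, y]
  map_add' y z := by
    simpa only [update_pair_one] using π.map_update_add ![x, 0] 1 y z
  map_smul' c y := by
    simpa only [update_pair_one, RingHom.id_apply] using π.map_update_smul ![x, 0] 1 c y

/-- The map `x ↦ {x, y}`. -/
def coadMap (π : MultilinearMap K (fun _ : Fin 2 => V) V) (y : V) : V →ₗ[K] V where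
  toFun x := π ![x, y]
  map_add' x z := by
    simpa only [update_pair_zero] using π.map_update_add ![0, y] 0 x z
  map_smul' c x := by
    simpa only [update_pair_zero, RingHom.id_apply] using π.map_update_smul ![0, y] 0 c x

theorem adMap_apply (x y : V) : adMap π x y = π ![x, y] := rfl
theorem coadMap_apply (x y : V) : coadMap π y x = π ![x, y] := rfl

/-- The contraction `f(x, -)`. -/
def contract {p : ℕ} (x : HVec 𝒱) (f : HCochain 𝒱 (p + 1)) : HCochain 𝒱 p :=
  fun u => f (Fin.cons x u)

/-- The sum of the values of a cochain with `{h, -}` applied to one of the arguments. -/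
def insSum (hπ : IsLodayBracket 𝒱 π) (h : HVec 𝒱) : (p : ℕ) → HCochain 𝒱 p →+ HCochain 𝒱 p
  | 0 => 0
  | p + 1 =>
    { toFun := fun f w => f (Fin.cons (h.br hπ (w 0)) (Fin.tail w)) +
        sgn (h.deg ⬝ᵥ (w 0).deg) • insSum hπ h p (contract (w 0) f) (Fin.tail w)
      map_zero' := by
        funext w
        have : contract (w 0) (0 : HCochain 𝒱 (p + 1)) = 0 := rfl
        simp [this]
      map_add' := fun f g => by
        funext w
        have : contract (w 0) (f + g) = contract (w 0) f + contract (w 0) g := rfl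
        simp only [this, map_add, Pi.add_apply, smul_add]
        abel }

theorem insSum_cons (hπ : IsLodayBracket 𝒱 π) (h : HVec 𝒱) {p : ℕ} (f : HCochain 𝒱 (p + 1))
    (x : HVec 𝒱) (u : Fin p → HVec 𝒱) :
    insSum hπ h (p + 1) f (Fin.cons x u) = f (Fin.cons (h.br hπ x) u) +
      sgn (h.deg ⬝ᵥ x.deg) • insSum hπ h p (contract x f) u := rfl

/-- The Lie derivative of a cochain of weight `B` along `h`. -/
def lieDer (hπ : IsLodayBracket 𝒱 π) (h : HVec 𝒱) (B : Deg n) {p : ℕ} :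
    HCochain 𝒱 p →+ HCochain 𝒱 p :=
  sgn (B ⬝ᵥ h.deg) • (adMap π h.val).toAddMonoidHom.compLeft _ - insSum hπ h p

theorem lieDer_apply (hπ : IsLodayBracket 𝒱 π) (h : HVec 𝒱) (B : Deg n) {p : ℕ}
    (f : HCochain 𝒱 p) (u : Fin p → HVec 𝒱) :
    lieDer hπ h B f u = sgn (B ⬝ᵥ h.deg) • adMap π h.val (f u) - insSum hπ h p f u := rfl

/-- The coboundary of a cochain of weight `B`. -/
def cobd (hπ : IsLodayBracket 𝒱 π) : (p : ℕ) → Deg n → HCochain 𝒱 p →+ HCochain 𝒱 (p + 1)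
  | 0, _ =>
    { toFun := fun f v => coadMap π (v 0).val (f Fin.elim0)
      map_zero' := by funext; simp
      map_add' := fun f g => by funext; simp }
  | p + 1, B =>
    { toFun := fun f v => -lieDer hπ (v 0) B f (Fin.tail v) -
        cobd hπ p (B + (v 0).deg) (contract (v 0) f) (Fin.tail v)
      map_zero' := by
        funext w
        have : contract (w 0) (0 : HCochain 𝒱 (p + 1)) = 0 := rfl
        simp [this]
      map_add' := fun f g => by
        funext w
        have : contract (w 0) (f + g) = contract (w 0) f + contract (w 0) g := rfl
        simp only [this, map_add, Pi.add_apply]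
        abel }

theorem cobd_zero (hπ : IsLodayBracket 𝒱 π) (B : Deg n) (f : HCochain 𝒱 0)
    (v : Fin 1 → HVec 𝒱) : cobd hπ 0 B f v = coadMap π (v 0).val (f Fin.elim0) := rfl

/-- Cartan's formula i_x d = -L_x - d i_x. It is the recursion that defines d; the weight grows by
the degree of the inserted vector. -/
theorem contract_cobd (hπ : IsLodayBracket 𝒱 π) {p : ℕ} (B : Deg n) (f : HCochain 𝒱 (p + 1))
    (x : HVec 𝒱) :
    contract x (cobd hπ (p + 1) B f) =
      -lieDer hπ x B f - cobd hπ p (B + x.deg) (contract x f) := rfl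

/-- Additivity in each argument, and homogeneity of weight `B`. -/
def IsCochain : {p : ℕ} → Deg n → HCochain 𝒱 p → Prop
  | 0, B, f => f Fin.elim0 ∈ 𝒱 B
  | _ + 1, B, f => (∀ (u : _) (x y z : HVec 𝒱) (c : ℤ), z.val = x.val + c • y.val →
      f (Fin.cons z u) = f (Fin.cons x u) + c • f (Fin.cons y u)) ∧
      ∀ x : HVec 𝒱, IsCochain (B + x.deg) (contract x f)

theorem contract_insSum (hπ : IsLodayBracket 𝒱 π) (h x : HVec 𝒱) {p : ℕ}
    (f : HCochain 𝒱 (p + 1)) :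
    contract x (insSum hπ h (p + 1) f) =
      contract (h.br hπ x) f + sgn (h.deg ⬝ᵥ x.deg) • insSum hπ h p (contract x f) := rfl

/-- L_h acts on the first argument as well, which produces the correction term i_{h,x}. In the
remaining term the sign ⟨h, x⟩ in front cancels the one that the weight `B + x.deg` brings into the
value part of L_h. -/
theorem contract_lieDer (hπ : IsLodayBracket 𝒱 π) (h x : HVec 𝒱) {p : ℕ} (B : Deg n)
    (f : HCochain 𝒱 (p + 1)) :
    contract x (lieDer hπ h B f) =
      sgn (h.deg ⬝ᵥ x.deg) • lieDer hπ h (B + x.deg) (contract x f) -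
        contract (h.br hπ x) f := by
  funext u
  simp only [contract, lieDer_apply, insSum_cons, Pi.sub_apply, Pi.smul_apply,
    sgn_dotProduct_add_left, dotProduct_comm x.deg h.deg]
  rcases sgn_eq_or (h.deg ⬝ᵥ x.deg) with e | e <;> simp [e] <;> abel

theorem insSum_adMap (hπ : IsLodayBracket 𝒱 π) (h : HVec 𝒱) (x : V) :
    ∀ {p : ℕ} (f : HCochain 𝒱 p), insSum hπ h p ((adMap π x).toAddMonoidHom.compLeft _ f) =
      (adMap π x).toAddMonoidHom.compLeft _ (insSum hπ h p f)
  | 0, f => by funext u; simp [insSum]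
  | p + 1, f => by
    funext u
    refine Fin.consCases (fun y u => ?_) u
    have := congrFun (insSum_adMap hπ h x (contract y f)) u
    have e : contract y ((adMap π x).toAddMonoidHom.compLeft _ f) =
        (adMap π x).toAddMonoidHom.compLeft _ (contract y f) := rfl
    rw [insSum_cons, e, this]
    simp [insSum_cons]

variable [DirectSum.Decomposition 𝒱]

/-- By linearity the third vector need not be homogeneous. This matters because the value of an
`HCochain` carries no degree. -/
theorem IsLodayBracket.jacobi (hπ : IsLodayBracket 𝒱 π) (x y : HVec 𝒱) (z : V) :
    adMap π x.val (adMap π y.val z) = adMap π (x.br hπ y).val z +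
      sgn (x.deg ⬝ᵥ y.deg) • adMap π y.val (adMap π x.val z) := by
  classical
  induction z using DirectSum.Decomposition.inductionOn 𝒱 with
  | zero => simp
  | homogeneous m => exact hπ.2 _ _ _ _ _ _ x.mem y.mem m.2
  | add a b ha hb => simp only [map_add, smul_add, ha, hb]; abel

/-- When `v` and `w` hit different arguments the terms agree up to the sign ⟨v, w⟩; when they hit
the same one, the Jacobi identity applies. Acting through the arguments reverses composition, which
accounts for the minus sign. -/
theorem insSum_comm (hπ : IsLodayBracket 𝒱 π) (v w : HVec 𝒱) :
    ∀ {p : ℕ} (B : Deg n) (f : HCochain 𝒱 p), IsCochain B f →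
      insSum hπ v p (insSum hπ w p f) = sgn (v.deg ⬝ᵥ w.deg) •
        (insSum hπ w p (insSum hπ v p f) - insSum hπ (v.br hπ w) p f)
  | 0, B, f, _ => by funext u; simp [insSum]
  | p + 1, B, f, hf => by
    funext u
    refine Fin.consCases (fun x u => ?_) u
    have ih := congrFun (insSum_comm hπ v w _ _ (hf.2 x)) u
    -- The additivity in `IsCochain` compares underlying vectors only, so the differently bracketed
    -- sums of degrees on the two sides need not be identified.
    have key : f (Fin.cons (v.br hπ (w.br hπ x)) u) = f (Fin.cons ((v.br hπ w).br hπ x) u) +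
        sgn (v.deg ⬝ᵥ w.deg) • f (Fin.cons (w.br hπ (v.br hπ x)) u) :=
      hf.1 _ _ _ _ _ (hπ.jacobi v w x.val)
    simp only [Pi.smul_apply, Pi.sub_apply, insSum_cons, contract_insSum, map_add, map_zsmul,
      Pi.add_apply, ih, key]
    have e : ∀ a b : HVec 𝒱, (a.br hπ b).deg = a.deg + b.deg := fun _ _ => rfl
    simp only [e, sgn_dotProduct_add_left, sgn_dotProduct_add_right,
      dotProduct_comm w.deg v.deg]
    have e' : ∀ y : HVec 𝒱, f (Fin.cons y u) = contract y f u := fun _ => rfl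
    rcases sgn_eq_or (v.deg ⬝ᵥ w.deg) with h1 | h1 <;>
    rcases sgn_eq_or (v.deg ⬝ᵥ x.deg) with h2 | h2 <;>
    rcases sgn_eq_or (w.deg ⬝ᵥ x.deg) with h3 | h3 <;>
    simp only [h1, h2, h3] <;> module

/-- The value parts obey the Jacobi identity, the argument parts obey `insSum_comm`, and the mixed
terms cancel because a bracket on the value commutes with brackets on the arguments. -/
theorem lieDer_comm (hπ : IsLodayBracket 𝒱 π) (v w : HVec 𝒱) {p : ℕ} (B : Deg n)
    (f : HCochain 𝒱 p) (hf : IsCochain B f) :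
    lieDer hπ v (B + w.deg) (lieDer hπ w B f) = sgn (v.deg ⬝ᵥ w.deg) •
      (lieDer hπ w (B + v.deg) (lieDer hπ v B f) + lieDer hπ (v.br hπ w) B f) := by
  have d : ∀ (h : HVec 𝒱) (C : Deg n) (g : HCochain 𝒱 p), lieDer hπ h C g =
    sgn (C ⬝ᵥ h.deg) • (adMap π h.val).toAddMonoidHom.compLeft _ g - insSum hπ h p g :=
    fun _ _ _ => rfl
  have e : ∀ a b : HVec 𝒱, (a.br hπ b).deg = a.deg + b.deg := fun _ _ => rfl
  funext u
  simp only [d, map_sub, map_zsmul, insSum_adMap, insSum_comm hπ v w B f hf, e,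
    sgn_dotProduct_add_left, sgn_dotProduct_add_right, dotProduct_comm w.deg v.deg]
  simp only [Pi.smul_apply, Pi.sub_apply, Pi.add_apply, AddMonoidHom.compLeft_apply,
    Function.comp_apply, LinearMap.toAddMonoidHom_coe, hπ.jacobi v w (f u)]
  rcases sgn_eq_or (v.deg ⬝ᵥ w.deg) with h1 | h1 <;>
  rcases sgn_eq_or (B ⬝ᵥ v.deg) with h2 | h2 <;>
  rcases sgn_eq_or (B ⬝ᵥ w.deg) with h3 | h3 <;>
  simp only [h1, h2, h3] <;> module

/-- Contract both sides with `w`. The terms containing d of a contraction match by induction, and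
what is left is the commutator relation `lieDer_comm`. -/
theorem lieDer_cobd (hπ : IsLodayBracket 𝒱 π) (v : HVec 𝒱) :
    ∀ {p : ℕ} (B : Deg n) (f : HCochain 𝒱 p), IsCochain B f →
      lieDer hπ v B (cobd hπ p B f) = cobd hπ p (B + v.deg) (lieDer hπ v B f)
  | 0, B, f, hf => by
    funext u
    refine Fin.consCases (fun w u => ?_) u
    -- In arity 0 the cochain is a vector of degree `B`, so the claim is the Jacobi identity for it.
    have key := hπ.jacobi v ⟨B, f Fin.elim0, hf⟩ w.val
    have e : insSum hπ v 1 (cobd hπ 0 B f) (Fin.cons w u) =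
        adMap π (f Fin.elim0) (adMap π v.val w.val) := by
      simp [insSum, cobd_zero, coadMap_apply, adMap_apply, HVec.br]
    rw [lieDer_apply, cobd_zero, cobd_zero, lieDer_apply, e]
    simp only [insSum, AddMonoidHom.zero_apply, Pi.zero_apply, sub_zero, Fin.cons_zero,
      coadMap_apply, adMap_apply, HVec.br, dotProduct_comm v.deg B] at key ⊢
    rw [key, smul_add, smul_smul, sgn_mul_self, one_smul, add_sub_cancel_right,
      ← coadMap_apply]
    exact (map_zsmul (coadMap π w.val) _ _).symm
  | p + 1, B, f, hf => by
    funext u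
    refine Fin.consCases (fun w u => ?_) u
    have ih := congrFun (lieDer_cobd hπ v _ _ (hf.2 w)) u
    have key := congrFun (lieDer_comm hπ v w B f hf) u
    have h1 := congrFun (contract_lieDer hπ v w B (cobd hπ (p + 1) B f)) u
    have h2 := congrFun (contract_cobd hπ (B + v.deg) (lieDer hπ v B f) w) u
    change lieDer hπ v B (cobd hπ (p + 1) B f) (Fin.cons w u) = _ at h1
    change cobd hπ (p + 1) (B + v.deg) (lieDer hπ v B f) (Fin.cons w u) = _ at h2
    have e : (v.br hπ w).deg = v.deg + w.deg := rfl
    rw [h1, h2, contract_lieDer]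
    simp only [contract_cobd, map_sub, map_neg, map_zsmul, Pi.sub_apply, Pi.smul_apply,
      Pi.neg_apply, ih, key, e, ← add_assoc, add_right_comm B w.deg v.deg]
    rcases sgn_eq_or (v.deg ⬝ᵥ w.deg) with h1 | h1 <;> simp only [h1, Pi.add_apply] <;> module

/-- Cartan's formula twice and L_v d = d L_v leave only d d i_v f, which vanishes by induction. -/
theorem cobd_cobd (hπ : IsLodayBracket 𝒱 π) :
    ∀ {p : ℕ} (B : Deg n) (f : HCochain 𝒱 p), IsCochain B f →
      cobd hπ (p + 1) B (cobd hπ p B f) = 0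
  | 0, B, f, hf => by
    funext u
    refine Fin.consCases (fun v u => ?_) u
    refine (congrFun (contract_cobd hπ B (cobd hπ 0 B f) v) u).trans ?_
    rw [Pi.sub_apply, Pi.neg_apply, lieDer_cobd hπ v B f hf]
    -- A Loday bracket need not be skew, but the graded symmetrization of {v, f} acts trivially from
    -- the left: substitute one Jacobi identity into the other.
    have k1 := hπ.jacobi v ⟨B, f Fin.elim0, hf⟩ (u 0).val
    have k2 := hπ.jacobi ⟨B, f Fin.elim0, hf⟩ v (u 0).val
    have e : contract v (cobd hπ 0 B f) Fin.elim0 = coadMap π v.val (f Fin.elim0) := rfl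
    simp only [cobd_zero, lieDer_apply, insSum, e, AddMonoidHom.zero_apply, Pi.zero_apply,
      sub_zero, map_zsmul]
    simp only [coadMap_apply, adMap_apply, HVec.br, dotProduct_comm v.deg B] at k1 k2 ⊢
    rw [k1, smul_add, smul_smul, sgn_mul_self, one_smul] at k2
    rw [← sub_eq_zero] at k2
    rw [← k2]
    abel
  | p + 1, B, f, hf => by
    funext u
    refine Fin.consCases (fun v u => ?_) u
    have ih := congrFun (cobd_cobd hπ _ _ (hf.2 v)) u
    refine (congrFun (contract_cobd hπ B (cobd hπ (p + 1) B f) v) u).trans ?_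
    rw [contract_cobd, lieDer_cobd hπ v B f hf]
    simp only [map_sub, map_neg, Pi.sub_apply, Pi.neg_apply, ih]
    simp

end Complex

/-! ### Splitting off the first index of sums over intervals and triangles -/

section FinSums

variable {M : Type*} [AddCommMonoid M] {p : ℕ}

theorem sum_Iio_eq_ite (i : Fin p) (g : Fin p → M) :
    ∑ l ∈ Finset.Iio i, g l = ∑ l, if l < i then g l else 0 := by
  rw [← Finset.sum_filter]
  congr 1
  ext; simp

theorem sum_Iic_eq_ite (i : Fin p) (g : Fin p → M) :
    ∑ l ∈ Finset.Iic i, g l = ∑ l, if l ≤ i then g l else 0 := by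
  rw [← Finset.sum_filter]
  congr 1
  ext; simp

theorem sum_Ioc_eq_ite (i j : Fin p) (g : Fin p → M) :
    ∑ l ∈ Finset.Ioc i j, g l = ∑ l, if i < l ∧ l ≤ j then g l else 0 := by
  rw [← Finset.sum_filter]
  congr 1
  ext; simp

theorem sum_Iio_succ (i : Fin p) (g : Fin (p + 1) → M) :
    ∑ l ∈ Finset.Iio i.succ, g l = g 0 + ∑ l ∈ Finset.Iio i, g l.succ := by
  simp [sum_Iio_eq_ite, Fin.sum_univ_succ]

theorem sum_Iic_succ (i : Fin p) (g : Fin (p + 1) → M) :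
    ∑ l ∈ Finset.Iic i.succ, g l = g 0 + ∑ l ∈ Finset.Iic i, g l.succ := by
  simp [sum_Iic_eq_ite, Fin.sum_univ_succ]

theorem sum_Ioc_succ (i j : Fin p) (g : Fin (p + 1) → M) :
    ∑ l ∈ Finset.Ioc i.succ j.succ, g l = ∑ l ∈ Finset.Ioc i j, g l.succ := by
  simp [sum_Ioc_eq_ite, Fin.sum_univ_succ]

theorem sum_triangle_succ (T : Fin (p + 1) → Fin (p + 1) → M) :
    ∑ i, ∑ j ∈ Finset.Iic i, T i j =
      (∑ i, T i 0) + ∑ i : Fin p, ∑ j ∈ Finset.Iic i, T i.succ j.succ := by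
  have e : Finset.Iic (0 : Fin (p + 1)) = {0} := by ext; simp
  rw [Fin.sum_univ_succ, Fin.sum_univ_succ, e, Finset.sum_singleton]
  simp only [sum_Iic_succ, Finset.sum_add_distrib, add_assoc]

theorem sum_Ioc_zero_castSucc (j : Fin (p + 1)) (g : Fin (p + 1) → M) :
    ∑ l ∈ Finset.Ioc 0 j, g l = ∑ l : Fin p, if l.castSucc < j then g l.succ else 0 := by
  rw [sum_Ioc_eq_ite, Fin.sum_univ_succ]
  simp [Fin.lt_def, Fin.le_def]

theorem sum_Iio_castSucc_lt (j : Fin (p + 1)) (g : Fin (p + 1) → M) :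
    ∑ l ∈ Finset.Iio j, g l = ∑ l : Fin p, if l.castSucc < j then g l.castSucc else 0 := by
  rw [sum_Iio_eq_ite, Fin.sum_univ_castSucc]
  simp [Fin.lt_def, Fin.not_lt.2 (Fin.le_last j)]

end FinSums

/-! ### The explicit formula as the solution of the recursion -/

section Explicit

variable {K V : Type*} [Field K] [AddCommGroup V] [Module K V] {n : ℕ}
  {𝒱 : Deg n → Submodule K V} {π : MultilinearMap K (fun _ : Fin 2 => V) V}

/-- Unrolled recursion: before it reaches argument `i`, `h` passes all earlier arguments and picks
up their signs. -/
theorem insSum_eq_sum (hπ : IsLodayBracket 𝒱 π) (h : HVec 𝒱) :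
    ∀ {p : ℕ} (f : HCochain 𝒱 p) (w : Fin p → HVec 𝒱), insSum hπ h p f w =
      ∑ i, sgn (h.deg ⬝ᵥ ∑ l ∈ Finset.Iio i, (w l).deg) •
        f (Function.update w i (h.br hπ (w i)))
  | 0, f, w => by simp [insSum]
  | p + 1, f, w => by
    refine Fin.consCases (fun x u => ?_) w
    rw [insSum_cons, insSum_eq_sum, Fin.sum_univ_succ]
    congr 1
    · have : Finset.Iio (0 : Fin (p + 1)) = ∅ := by ext; simp
      simp [this, Fin.update_cons_zero]
    · rw [Finset.smul_sum]
      refine Finset.sum_congr rfl fun i _ => ?_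
      rw [sum_Iio_succ]
      simp only [Fin.cons_zero, Fin.cons_succ, sgn_dotProduct_add_right, mul_smul,
        ← Fin.cons_update]
      rfl

/-- The explicit formula for the coboundary of a cochain of weight `B`. -/
def explicitCobd (hπ : IsLodayBracket 𝒱 π) {p : ℕ} (B : Deg n) (f : HCochain 𝒱 p)
    (v : Fin (p + 1) → HVec 𝒱) : V :=
  sgn (p : ℤ) • π ![f (Fin.init v), (v (Fin.last p)).val] -
    (∑ i : Fin p, (sgn (i.val : ℤ) *
      sgn ((B + ∑ l ∈ Finset.Iio i.castSucc, (v l).deg) ⬝ᵥ (v i.castSucc).deg)) •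
      π ![(v i.castSucc).val, f (i.castSucc.removeNth v)]) +
    ∑ i : Fin p, ∑ j ∈ Finset.Iic i, (sgn (j.val : ℤ) *
      sgn ((v j.castSucc).deg ⬝ᵥ ∑ l ∈ Finset.Ioc j i, (v l.castSucc).deg)) •
      f (j.castSucc.removeNth (Function.update v i.succ ((v j.castSucc).br hπ (v i.succ))))

theorem removeNth_succ_cons {X : Type*} {p : ℕ} (i : Fin (p + 1)) (x : X) (u : Fin (p + 1) → X) :
    i.succ.removeNth (Fin.cons x u : Fin (p + 2) → X) =
      (Fin.cons x (i.removeNth u) : Fin (p + 1) → X) := by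
  funext k
  refine Fin.cases ?_ (fun k => ?_) k <;> simp [Fin.removeNth]

theorem removeNth_zero_cons {X : Type*} {p : ℕ} (x : X) (u : Fin p → X) :
    (0 : Fin (p + 1)).removeNth (Fin.cons x u : Fin (p + 1) → X) = u := by
  funext k
  simp [Fin.removeNth]

theorem init_cons {X : Type*} {p : ℕ} (x : X) (u : Fin (p + 1) → X) :
    Fin.init (Fin.cons x u : Fin (p + 2) → X) = (Fin.cons x (Fin.init u) : Fin (p + 1) → X) := by
  funext k
  refine Fin.cases ?_ (fun k => ?_) k <;> simp [Fin.init]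

/-- The terms in which `x` leaves its place are the first summand of the single sum and the column j
= 0 of the double sum; together they form -L_x f. All other terms keep `x` in front and make up the
formula for i_x f, with opposite sign since every index drops by one. -/
theorem explicitCobd_cons (hπ : IsLodayBracket 𝒱 π) {p : ℕ} (B : Deg n)
    (f : HCochain 𝒱 (p + 1)) (x : HVec 𝒱) (u : Fin (p + 1) → HVec 𝒱) :
    explicitCobd hπ B f (Fin.cons x u) =
      -lieDer hπ x B f u - explicitCobd hπ (B + x.deg) (contract x f) u := by
  have e0 : Finset.Iio (0 : Fin (p + 1 + 1)) = ∅ := by ext; simp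
  have t1 : sgn ((p + 1 : ℕ) : ℤ) • π ![f (Fin.init (Fin.cons x u : Fin (p + 2) → HVec 𝒱)),
      ((Fin.cons x u : Fin (p + 2) → HVec 𝒱) (Fin.last (p + 1))).val] =
      - (sgn (p : ℤ) • π ![contract x f (Fin.init u), (u (Fin.last p)).val]) := by
    rw [init_cons, ← Fin.succ_last, Fin.cons_succ]
    simp [sgn_add, contract]
  have t2 : (∑ i : Fin (p + 1), (sgn (i.val : ℤ) *
      sgn ((B + ∑ l ∈ Finset.Iio i.castSucc, ((Fin.cons x u : Fin (p + 2) → HVec 𝒱) l).deg) ⬝ᵥ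
        ((Fin.cons x u : Fin (p + 2) → HVec 𝒱) i.castSucc).deg)) •
      π ![((Fin.cons x u : Fin (p + 2) → HVec 𝒱) i.castSucc).val,
        f (i.castSucc.removeNth (Fin.cons x u : Fin (p + 2) → HVec 𝒱))]) =
      sgn (B ⬝ᵥ x.deg) • adMap π x.val (f u) -
      ∑ i : Fin p, (sgn (i.val : ℤ) *
      sgn ((B + x.deg + ∑ l ∈ Finset.Iio i.castSucc, (u l).deg) ⬝ᵥ (u i.castSucc).deg)) •
      π ![(u i.castSucc).val, contract x f (i.castSucc.removeNth u)] := by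
    rw [Fin.sum_univ_succ, sub_eq_add_neg, ← Finset.sum_neg_distrib]
    congr 1
    · simp [e0, adMap_apply]
    · refine Finset.sum_congr rfl fun i _ => ?_
      rw [← Fin.succ_castSucc, sum_Iio_succ, removeNth_succ_cons]
      simp [sgn_add, contract, add_assoc]
  have t3 : (∑ i : Fin (p + 1), ∑ j ∈ Finset.Iic i, (sgn (j.val : ℤ) *
      sgn (((Fin.cons x u : Fin (p + 2) → HVec 𝒱) j.castSucc).deg ⬝ᵥ
        ∑ l ∈ Finset.Ioc j i, ((Fin.cons x u : Fin (p + 2) → HVec 𝒱) l.castSucc).deg)) •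
      f (j.castSucc.removeNth (Function.update (Fin.cons x u : Fin (p + 2) → HVec 𝒱) i.succ
        (((Fin.cons x u : Fin (p + 2) → HVec 𝒱) j.castSucc).br hπ
          ((Fin.cons x u : Fin (p + 2) → HVec 𝒱) i.succ))))) =
      insSum hπ x _ f u - ∑ i : Fin p, ∑ j ∈ Finset.Iic i, (sgn (j.val : ℤ) *
      sgn ((u j.castSucc).deg ⬝ᵥ ∑ l ∈ Finset.Ioc j i, (u l.castSucc).deg)) •
      contract x f (j.castSucc.removeNth
        (Function.update u i.succ ((u j.castSucc).br hπ (u i.succ)))) := by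
    rw [sum_triangle_succ, insSum_eq_sum, sub_eq_add_neg, ← Finset.sum_neg_distrib]
    congr 1
    · refine Finset.sum_congr rfl fun i _ => ?_
      rw [sum_Ioc_zero_castSucc, sum_Iio_castSucc_lt]
      simp [← Fin.cons_update]
    · refine Finset.sum_congr rfl fun i _ => ?_
      rw [← Finset.sum_neg_distrib]
      refine Finset.sum_congr rfl fun j _ => ?_
      rw [sum_Ioc_succ, ← Fin.succ_castSucc, Fin.cons_succ, Fin.cons_succ, ← Fin.cons_update,
        removeNth_succ_cons]
      simp [sgn_add, contract]
  unfold explicitCobd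
  rw [t1, t2, t3, lieDer_apply]
  abel

theorem cobd_eq_explicitCobd (hπ : IsLodayBracket 𝒱 π) :
    ∀ {p : ℕ} (B : Deg n) (f : HCochain 𝒱 p) (v : Fin (p + 1) → HVec 𝒱),
      cobd hπ p B f v = explicitCobd hπ B f v
  | 0, B, f, v => by
    rw [cobd_zero, coadMap_apply, explicitCobd]
    simp
    congr
    exact Subsingleton.elim _ _
  | p + 1, B, f, v => by
    refine Fin.consCases (fun x u => ?_) v
    rw [explicitCobd_cons, ← cobd_eq_explicitCobd]
    rfl

end Explicit

/-! ### Graded skew-symmetry through contractions -/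

section Skew

variable {K V : Type*} [Field K] [AddCommGroup V] [Module K V] {n : ℕ}
  {𝒱 : Deg n → Submodule K V} {π : MultilinearMap K (fun _ : Fin 2 => V) V}

/-- Graded skew-symmetry of a cochain on homogeneous vectors. -/
def HSkew : {p : ℕ} → HCochain 𝒱 p → Prop
  | 0, _ => True
  | 1, _ => True
  | _ + 2, f => (∀ (x y : HVec 𝒱) u, f (Fin.cons y (Fin.cons x u)) =
      -(sgn (x.deg ⬝ᵥ y.deg) • f (Fin.cons x (Fin.cons y u)))) ∧ ∀ x, HSkew (contract x f)

theorem hSkew_contract {p : ℕ} {f : HCochain 𝒱 (p + 1)} (hf : HSkew f) (x : HVec 𝒱) :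
    HSkew (contract x f) := by
  cases p with
  | zero => trivial
  | succ p => exact hf.2 x

theorem HSkew.add : ∀ {p : ℕ} {f g : HCochain 𝒱 p}, HSkew f → HSkew g → HSkew (f + g)
  | 0, _, _, _, _ => trivial
  | 1, _, _, _, _ => trivial
  | _ + 2, f, g, hf, hg => ⟨fun x y u => by
      simp only [Pi.add_apply, hf.1 x y, hg.1 x y, smul_add]; abel,
      fun x => (hf.2 x).add (hg.2 x)⟩

theorem HSkew.compLeft (φ : V →+ V) :
    ∀ {p : ℕ} {f : HCochain 𝒱 p}, HSkew f → HSkew (φ.compLeft _ f)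
  | 0, _, _ => trivial
  | 1, _, _ => trivial
  | _ + 2, f, hf => ⟨fun x y u => by
      simp only [AddMonoidHom.compLeft_apply, Function.comp_apply, hf.1 x y, map_neg, map_zsmul],
      fun x => (hf.2 x).compLeft φ⟩

theorem HSkew.zsmul {p : ℕ} {f : HCochain 𝒱 p} (hf : HSkew f) (c : ℤ) : HSkew (c • f) := by
  have := hf.compLeft (zsmulAddGroupHom c)
  exact this

theorem HSkew.neg {p : ℕ} {f : HCochain 𝒱 p} (hf : HSkew f) : HSkew (-f) := by
  simpa using hf.zsmul (-1)

theorem HSkew.sub {p : ℕ} {f g : HCochain 𝒱 p} (hf : HSkew f) (hg : HSkew g) :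
    HSkew (f - g) := by
  rw [sub_eq_add_neg]
  exact hf.add hg.neg

theorem HSkew.contract_contract {p : ℕ} {f : HCochain 𝒱 (p + 2)} (hf : HSkew f)
    (x y : HVec 𝒱) : contract x (contract y f) =
      -(sgn (x.deg ⬝ᵥ y.deg) • contract y (contract x f)) :=
  funext fun u => hf.1 x y u

/-- Exchanging the first two arguments swaps the terms where `h` hits the one or the other and
preserves the family where it hits a later argument; later transpositions are handled after
contraction. -/
theorem hSkew_insSum (hπ : IsLodayBracket 𝒱 π) (h : HVec 𝒱) :
    ∀ {p : ℕ} {f : HCochain 𝒱 p}, HSkew f → HSkew (insSum hπ h p f)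
  | 0, _, _ => trivial
  | 1, _, _ => trivial
  | p + 2, f, hf => by
    refine ⟨fun x y u => ?_, fun x => ?_⟩
    · have e1 : ∀ a b, contract a f (Fin.cons b u) = f (Fin.cons a (Fin.cons b u)) :=
        fun _ _ => rfl
      have e : (h.br hπ x).deg = h.deg + x.deg := rfl
      have e2 : (h.br hπ y).deg = h.deg + y.deg := rfl
      simp only [insSum_cons, e1]
      rw [hf.1 x (h.br hπ y), hf.1 (h.br hπ x) y, hf.contract_contract x y]
      simp only [map_neg, map_zsmul, e, e2, sgn_dotProduct_add_left, sgn_dotProduct_add_right,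
        dotProduct_comm x.deg h.deg, Pi.neg_apply, Pi.smul_apply]
      rcases sgn_eq_or (h.deg ⬝ᵥ x.deg) with h1 | h1 <;>
      rcases sgn_eq_or (h.deg ⬝ᵥ y.deg) with h2 | h2 <;>
      rcases sgn_eq_or (x.deg ⬝ᵥ y.deg) with h3 | h3 <;>
      simp only [h1, h2, h3] <;> module
    · rw [contract_insSum]
      exact (hf.2 _).add ((hSkew_insSum hπ h (hf.2 x)).zsmul _)

theorem hSkew_lieDer (hπ : IsLodayBracket 𝒱 π) (h : HVec 𝒱) (B : Deg n) {p : ℕ}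
    {f : HCochain 𝒱 p} (hf : HSkew f) : HSkew (lieDer hπ h B f) :=
  ((hf.compLeft _).zsmul _).sub (hSkew_insSum hπ h hf)

theorem IsCochain.contract_eq_zsmul {p : ℕ} {B : Deg n} {f : HCochain 𝒱 (p + 1)}
    (hf : IsCochain B f) {x y : HVec 𝒱} {c : ℤ} (h : y.val = c • x.val) :
    contract y f = c • contract x f := by
  funext u
  -- Writing c x as x + (c - 1) x fits the affine form of additivity in `IsCochain`.
  have := hf.1 u x x y (c - 1) (by rw [h]; module)
  simp only [contract, Pi.smul_apply, this]
  module

theorem IsGradedSkew.bracket_comm (hs : IsGradedSkew 𝒱 π) (x y : HVec 𝒱) :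
    π ![y.val, x.val] = -(sgn (x.deg ⬝ᵥ y.deg) • π ![x.val, y.val]) := by
  have h := hs 0 1 rfl ![x.deg, y.deg] ![x.val, y.val]
    (by intro i; fin_cases i <;> simp [x.mem, y.mem])
  have e : ![x.val, y.val] ∘ Equiv.swap (0 : Fin 2) 1 = ![y.val, x.val] := by
    funext i; fin_cases i <;> simp
  rw [e] at h
  exact h

/-- For a skew bracket, Cartan's formula persists in arity 0 with the contraction read as zero. This
is what makes arity 1 work in `hSkew_cobd`. -/
theorem contract_cobd_zero (hπ : IsLodayBracket 𝒱 π) (hs : IsGradedSkew 𝒱 π) {B : Deg n}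
    {f : HCochain 𝒱 0} (hf : IsCochain B f) (x : HVec 𝒱) :
    contract x (cobd hπ 0 B f) = -lieDer hπ x B f := by
  funext u
  have h := hs.bracket_comm x ⟨B, f Fin.elim0, hf⟩
  have e : contract x (cobd hπ 0 B f) u = π ![f Fin.elim0, x.val] := rfl
  rw [e, Pi.neg_apply, lieDer_apply, h, Subsingleton.elim u Fin.elim0, dotProduct_comm]
  simp [insSum, adMap_apply]

/-- Cartan's formula applied twice. For skew bracket and cochain, exchanging `x` and `y` swaps the
two Lie derivative terms and multiplies the first and last terms by the skew sign. -/
theorem contract_contract_cobd (hπ : IsLodayBracket 𝒱 π) {p : ℕ} (B : Deg n)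
    (f : HCochain 𝒱 (p + 2)) (x y : HVec 𝒱) :
    contract y (contract x (cobd hπ (p + 2) B f)) = contract (x.br hπ y) f -
      sgn (x.deg ⬝ᵥ y.deg) • lieDer hπ x (B + y.deg) (contract y f) +
      lieDer hπ y (B + x.deg) (contract x f) +
      cobd hπ p (B + x.deg + y.deg) (contract y (contract x f)) := by
  have e1 : ∀ g h : HCochain 𝒱 (p + 2), contract y (-g - h) = -contract y g - contract y h :=
    fun _ _ => rfl
  rw [contract_cobd, e1, contract_lieDer, contract_cobd]
  abel

theorem contract_contract_cobd_one (hπ : IsLodayBracket 𝒱 π) (hs : IsGradedSkew 𝒱 π)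
    {B : Deg n} {f : HCochain 𝒱 1} (hf : IsCochain B f) (x y : HVec 𝒱) :
    contract y (contract x (cobd hπ 1 B f)) = contract (x.br hπ y) f -
      sgn (x.deg ⬝ᵥ y.deg) • lieDer hπ x (B + y.deg) (contract y f) +
      lieDer hπ y (B + x.deg) (contract x f) := by
  have e1 : ∀ g h : HCochain 𝒱 1, contract y (-g - h) = -contract y g - contract y h :=
    fun _ _ => rfl
  rw [contract_cobd, e1, contract_lieDer, contract_cobd_zero hπ hs (hf.2 x)]
  abel

/-- For a graded Lie bracket, the coboundary preserves graded skew-symmetry. -/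
theorem hSkew_cobd (hπ : IsLodayBracket 𝒱 π) (hs : IsGradedSkew 𝒱 π) :
    ∀ {p : ℕ} {B : Deg n} {f : HCochain 𝒱 p}, IsCochain B f → HSkew f → HSkew (cobd hπ p B f)
  | 0, _, _, _, _ => trivial
  | 1, B, f, hf, _ => by
    refine ⟨fun x y u => ?_, fun x => trivial⟩
    have h1 := congrFun (contract_contract_cobd_one hπ hs hf x y) u
    have h2 := congrFun (contract_contract_cobd_one hπ hs hf y x) u
    have h3 : contract (y.br hπ x) f = -sgn (x.deg ⬝ᵥ y.deg) • contract (x.br hπ y) f :=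
      hf.contract_eq_zsmul (by rw [neg_smul]; exact hs.bracket_comm x y)
    refine h2.trans (Eq.trans ?_ (congrArg (fun t => -(sgn (x.deg ⬝ᵥ y.deg) • t)) h1.symm))
    rw [h3, dotProduct_comm y.deg]
    simp only [Pi.add_apply, Pi.sub_apply, Pi.smul_apply]
    rcases sgn_eq_or (x.deg ⬝ᵥ y.deg) with h3 | h3 <;> simp only [h3] <;> module
  | p + 2, B, f, hf, hk => by
    refine ⟨fun x y u => ?_, fun x => ?_⟩
    · have h1 := congrFun (contract_contract_cobd hπ B f x y) u
      have h2 := congrFun (contract_contract_cobd hπ B f y x) u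
      have h3 : contract (y.br hπ x) f = -sgn (x.deg ⬝ᵥ y.deg) • contract (x.br hπ y) f :=
        hf.contract_eq_zsmul (by rw [neg_smul]; exact hs.bracket_comm x y)
      refine h2.trans (Eq.trans ?_ (congrArg (fun t => -(sgn (x.deg ⬝ᵥ y.deg) • t)) h1.symm))
      rw [h3, hk.contract_contract x y, add_right_comm B y.deg x.deg, dotProduct_comm y.deg]
      simp only [Pi.add_apply, Pi.sub_apply, Pi.smul_apply, map_neg, map_zsmul, Pi.neg_apply]
      rcases sgn_eq_or (x.deg ⬝ᵥ y.deg) with h3 | h3 <;> simp only [h3] <;> module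
    -- Transpositions beyond the first argument: both terms of Cartan's formula are skew, the second
    -- one by induction on the arity.
    · rw [contract_cobd]
      exact (hSkew_lieDer hπ x B hk).neg.sub (hSkew_cobd hπ hs (hf.2 x) (hSkew_contract hk x))

theorem cons_comp_swap_succ {X : Type*} {p : ℕ} (x : X) (u : Fin p → X) (i j : Fin p) :
    (Fin.cons x u : Fin (p + 1) → X) ∘ Equiv.swap i.succ j.succ =
      (Fin.cons x (u ∘ Equiv.swap i j) : Fin (p + 1) → X) := by
  funext k
  refine Fin.cases ?_ (fun k => ?_) k
  · simp [Equiv.swap_apply_of_ne_of_ne (Fin.succ_ne_zero i).symm (Fin.succ_ne_zero j).symm]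
  · simp only [Function.comp_apply, Fin.cons_succ, (Fin.succ_injective p).swap_apply]

theorem cons_cons_comp_swap {X : Type*} {p : ℕ} (x y : X) (u : Fin p → X) :
    (Fin.cons x (Fin.cons y u : Fin (p + 1) → X) : Fin (p + 2) → X) ∘ Equiv.swap 0 1 =
      (Fin.cons y (Fin.cons x u : Fin (p + 1) → X) : Fin (p + 2) → X) := by
  funext k
  refine Fin.cases ?_ (fun k => Fin.cases ?_ (fun k => ?_) k) k
  · rfl
  · rfl
  · rw [Function.comp_apply, Equiv.swap_apply_of_ne_of_ne (Fin.succ_ne_zero k.succ)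
      (show k.succ.succ ≠ 1 from fun h => Fin.succ_ne_zero k (Fin.succ_injective _ h))]
    rfl

/-- A transposition either exchanges the first two arguments or fixes the first one, and then it
acts on a contraction. -/
theorem hSkew_iff : ∀ {p : ℕ} {f : HCochain 𝒱 p}, HSkew f ↔
    ∀ i j : Fin p, j.val = i.val + 1 → ∀ w : Fin p → HVec 𝒱,
      f (w ∘ Equiv.swap i j) = -(sgn ((w i).deg ⬝ᵥ (w j).deg) • f w)
  | 0, f => ⟨fun _ i => i.elim0, fun _ => trivial⟩
  | 1, f => ⟨fun _ i j h => by omega, fun _ => trivial⟩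
  | p + 2, f => by
    constructor
    · intro hf i j hij w
      refine Fin.consCases (fun x w => ?_) w
      induction j using Fin.cases with
      | zero => simp at hij
      | succ j =>
        induction i using Fin.cases with
        | zero =>
          obtain rfl : j = 0 := by ext; simpa using hij
          refine Fin.consCases (fun y u => ?_) w
          refine (congrArg f (cons_cons_comp_swap x y u)).trans (hf.1 x y u)
        | succ i =>
          rw [cons_comp_swap_succ]
          exact hSkew_iff.1 (hf.2 x) i j (by simpa using hij) w
    · intro hf
      refine ⟨fun x y u => ?_, fun x => hSkew_iff.2 fun i j hij w => ?_⟩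
      · have := hf 0 1 rfl (Fin.cons x (Fin.cons y u))
        rw [cons_cons_comp_swap] at this
        exact this
      · have := hf i.succ j.succ (by simpa using hij) (Fin.cons x w)
        rw [cons_comp_swap_succ] at this
        exact this

end Skew

/-! ### From multilinear maps to cochains on homogeneous vectors -/

section Multilinear

variable {K V : Type*} [Field K] [AddCommGroup V] [Module K V] {n : ℕ}
  {𝒱 : Deg n → Submodule K V} {π : MultilinearMap K (fun _ : Fin 2 => V) V}

/-- The restriction of a multilinear map to homogeneous vectors. -/
def toHCochain (𝒱 : Deg n → Submodule K V) {p : ℕ} (f : MultilinearMap K (fun _ : Fin p => V) V) :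
    HCochain 𝒱 p := fun w => f fun i => (w i).val

theorem contract_toHCochain {p : ℕ} (f : MultilinearMap K (fun _ : Fin (p + 1) => V) V)
    (x : HVec 𝒱) : contract x (toHCochain 𝒱 f) = toHCochain 𝒱 (f.curryLeft x.val) := by
  funext u
  simp only [contract, toHCochain, MultilinearMap.curryLeft_apply]
  congr 1
  funext i
  refine Fin.cases ?_ (fun i => ?_) i <;> simp

theorem curryLeft_mem_weightMaps {p : ℕ} {B : Deg n}
    {f : MultilinearMap K (fun _ : Fin (p + 1) => V) V} (hf : f ∈ weightMaps 𝒱 B (p + 1))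
    (x : HVec 𝒱) : f.curryLeft x.val ∈ weightMaps 𝒱 (B + x.deg) p := by
  intro α v hv
  have := hf (Fin.cons x.deg α) (Fin.cons x.val v)
    (fun i => Fin.cases x.mem (fun i => by simpa using hv i) i)
  rw [Fin.sum_cons, ← add_assoc] at this
  exact this

theorem isCochain_toHCochain : ∀ {p : ℕ} {B : Deg n}
    {f : MultilinearMap K (fun _ : Fin p => V) V}, f ∈ weightMaps 𝒱 B p →
      IsCochain B (toHCochain 𝒱 f)
  | 0, B, f, hf => by
    have := hf Fin.elim0 Fin.elim0 (fun i => i.elim0)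
    simp at this
    simp only [IsCochain, toHCochain]
    convert this
  | p + 1, B, f, hf => by
    refine ⟨fun u x y z c h => ?_, fun x => ?_⟩
    · have e := fun x : HVec 𝒱 => congrFun (contract_toHCochain f x) u
      simp only [contract] at e
      rw [e, e, e, h, map_add, map_zsmul]
      rfl
    · rw [contract_toHCochain]
      exact isCochain_toHCochain (curryLeft_mem_weightMaps hf x)

theorem hSkew_toHCochain {p : ℕ} {f : MultilinearMap K (fun _ : Fin p => V) V} :
    HSkew (toHCochain 𝒱 f) ↔ IsGradedSkew 𝒱 f := by
  rw [hSkew_iff]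
  constructor
  · intro h i j hij α v hv
    exact h i j hij fun l => ⟨α l, v l, hv l⟩
  · intro h i j hij w
    exact h i j hij (fun l => (w l).deg) (fun l => (w l).val) fun l => (w l).mem

theorem insSum_mem (hπ : IsLodayBracket 𝒱 π) (h : HVec 𝒱) : ∀ {p : ℕ} (B : Deg n)
    {f : HCochain 𝒱 p}, (∀ w, f w ∈ 𝒱 (B + ∑ i, (w i).deg)) →
      ∀ w, insSum hπ h p f w ∈ 𝒱 (B + h.deg + ∑ i, (w i).deg)
  | 0, B, f, _, w => by simp [insSum]
  | p + 1, B, f, hf, w => by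
    refine Fin.consCases (fun x u => ?_) w
    rw [insSum_cons]
    refine add_mem ?_ (zsmul_mem ?_ _)
    · convert hf (Fin.cons (h.br hπ x) u) using 2
      simp [Fin.sum_univ_succ, HVec.br, add_assoc]
    · have := insSum_mem hπ h (B + x.deg) (f := contract x f) (fun w => by
        have := hf (Fin.cons x w)
        rwa [Fin.sum_univ_succ, ← add_assoc] at this) u
      convert this using 2
      simp only [Fin.sum_univ_succ, Fin.cons_zero, Fin.cons_succ]
      abel

theorem lieDer_mem (hπ : IsLodayBracket 𝒱 π) (h : HVec 𝒱) {p : ℕ} (B : Deg n)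
    {f : HCochain 𝒱 p} (hf : ∀ w, f w ∈ 𝒱 (B + ∑ i, (w i).deg)) (w : Fin p → HVec 𝒱) :
    lieDer hπ h B f w ∈ 𝒱 (B + h.deg + ∑ i, (w i).deg) := by
  refine sub_mem (zsmul_mem ?_ _) (insSum_mem hπ h B hf w)
  have := hπ.bracket_mem h.mem (hf w)
  rwa [← add_assoc, add_comm h.deg B] at this

theorem cobd_mem (hπ : IsLodayBracket 𝒱 π) : ∀ {p : ℕ} (B : Deg n)
    {f : HCochain 𝒱 p}, (∀ w, f w ∈ 𝒱 (B + ∑ i, (w i).deg)) →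
      ∀ v, cobd hπ p B f v ∈ 𝒱 (B + ∑ i, (v i).deg)
  | 0, B, f, hf, v => by
    have := hπ.bracket_mem (hf Fin.elim0) (v 0).mem
    simp only [Finset.univ_eq_empty, Finset.sum_empty, add_zero] at this
    rw [Fin.sum_univ_one]
    exact this
  | p + 1, B, f, hf, v => by
    refine Fin.consCases (fun x u => ?_) v
    have e : ∑ i, ((Fin.cons x u : Fin (p + 2) → HVec 𝒱) i).deg = x.deg + ∑ i, (u i).deg := by
      simp [Fin.sum_univ_succ]
    rw [e, ← add_assoc]
    refine sub_mem (neg_mem (lieDer_mem hπ x B hf u)) (cobd_mem hπ (B + x.deg) (fun w => ?_) u)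
    have := hf (Fin.cons x w)
    rwa [Fin.sum_univ_succ, ← add_assoc] at this

end Multilinear

/-! ### Words in the tensor algebra -/

section Words

variable {K W : Type*} [Field K] [AddCommGroup W] [Module K W]

@[simp] theorem word_empty {p : ℕ} (v : Fin p → W) : word K v ∅ = 1 := by
  simp [word]

@[simp] theorem word_singleton {p : ℕ} (v : Fin p → W) (i : Fin p) :
    word K v {i} = TensorAlgebra.ι K (v i) := by
  simp [word]

theorem word_union {p : ℕ} (v : Fin p → W) {I J : Finset (Fin p)}
    (h : ∀ i ∈ I, ∀ j ∈ J, i < j) : word K v (I ∪ J) = word K v I * word K v J := by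
  have hd : Disjoint I J := Finset.disjoint_left.2 fun i hi hj => lt_irrefl _ (h i hi i hj)
  have e : (I ∪ J).sort (· ≤ ·) = I.sort (· ≤ ·) ++ J.sort (· ≤ ·) := by
    refine List.Perm.eq_of_pairwise' (r := (· ≤ ·)) (Finset.pairwise_sort _ _) ?_ ?_
    · refine List.pairwise_append.2 ⟨Finset.pairwise_sort _ _, Finset.pairwise_sort _ _, ?_⟩
      intro a ha b hb
      exact (h a ((Finset.mem_sort _).1 ha) b ((Finset.mem_sort _).1 hb)).le
    · refine (List.perm_ext_iff_of_nodup (Finset.sort_nodup _ _) ?_).2 fun a => ?_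
      · refine List.Nodup.append (Finset.sort_nodup _ _) (Finset.sort_nodup _ _) ?_
        intro a ha hb
        exact Finset.disjoint_left.1 hd ((Finset.mem_sort _).1 ha) ((Finset.mem_sort _).1 hb)
      · simp
  rw [word, e, List.map_append, List.prod_append]
  rfl

theorem word_eq_tprod {p m : ℕ} (v : Fin p → W) (I : Finset (Fin p)) (h : I.card = m) :
    word K v I = TensorAlgebra.tprod K W m (v ∘ I.orderEmbOfFin h) := by
  rw [word, ← Finset.listMap_orderEmbOfFin_finRange I h, TensorAlgebra.tprod_apply,
    List.map_map, List.ofFn_eq_map]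
  rfl

theorem word_compl_singleton {m : ℕ} (v : Fin (m + 1) → W) (i : Fin (m + 1)) :
    word K v {i}ᶜ = TensorAlgebra.tprod K W m (i.removeNth v) := by
  have h : ({i}ᶜ : Finset (Fin (m + 1))).card = m := by simp [Finset.card_compl]
  rw [word_eq_tprod v _ h, Finset.orderEmbOfFin_compl_singleton]
  rfl

theorem tprod_pair (x y : W) : TensorAlgebra.tprod K W 2 ![x, y] =
    TensorAlgebra.ι K x * TensorAlgebra.ι K y := by
  simp [TensorAlgebra.tprod_apply, List.ofFn_succ]

end Words

/-! ### The coderivation in the three lengths that occur -/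

section CoderFormulas

variable {K W : Type*} [Field K] [AddCommGroup W] [Module K W] {n : ℕ}
  (𝒲 : Deg n → Submodule K W) [DirectSum.Decomposition 𝒲]

/-- The only index set of full size is everything, so nothing stands before or after `q` and no sign
arises. -/
theorem coder_tprod_self {a : ℕ} (Q : Deg n) (q : MultilinearMap K (fun _ : Fin (a + 1) => W) W)
    (α : Fin (a + 1) → Deg n) (v : Fin (a + 1) → W) (hv : ∀ i, v i ∈ 𝒲 (α i)) :
    coder 𝒲 Q q (TensorAlgebra.tprod K W (a + 1) v) = TensorAlgebra.ι K (q v) := by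
  rw [coder_tprod 𝒲 Q q α v hv]
  let S₀ : {S : Finset (Fin (a + 1)) // S.card = a + 1} := ⟨Finset.univ, by simp⟩
  have huniq : ∀ S, S = S₀ := fun S => Subtype.ext ((Finset.card_eq_iff_eq_univ _).1 (by simp [S.2]))
  have hemb : ⇑(S₀.1.orderEmbOfFin S₀.2) = id :=
    (Finset.orderEmbOfFin_unique S₀.2 (f := id) (fun _ => Finset.mem_univ _) strictMono_id).symm
  have htop : top S₀ = Fin.last a := by rw [top, hemb]; rfl
  have hb : before S₀ = ∅ := by ext; simp [before, S₀]
  have ha : after S₀ = ∅ := by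
    ext i; simp [after, htop, Fin.le_last]
  rw [Fintype.sum_eq_single S₀ fun S hS => absurd (huniq S) hS, hemb, hb, ha, codSign, hb]
  simp

/-- An index set of size b + 1 omits one index. If that index is not the last, its vector stands
alone in front of `q`, and the sign comes from moving it there and from `q` passing it. If it is the
last, its vector follows `q` without sign. -/
theorem coder_tprod_succ {b : ℕ} (Q : Deg n) (q : MultilinearMap K (fun _ : Fin (b + 1) => W) W)
    (α : Fin (b + 2) → Deg n) (v : Fin (b + 2) → W) (hv : ∀ i, v i ∈ 𝒲 (α i)) :
    coder 𝒲 Q q (TensorAlgebra.tprod K W (b + 2) v) =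
      (∑ i : Fin (b + 1), sgn ((∑ j ∈ Finset.Iio i.castSucc, α i.castSucc ⬝ᵥ α j) +
        Q ⬝ᵥ α i.castSucc) •
        TensorAlgebra.tprod K W 2 ![v i.castSucc, q (i.castSucc.removeNth v)]) +
      TensorAlgebra.tprod K W 2 ![q (Fin.init v), v (Fin.last (b + 1))] := by
  rw [coder_tprod 𝒲 Q q α v hv]
  let S : Fin (b + 2) → {S : Finset (Fin (b + 2)) // S.card = b + 1} := fun i =>
    ⟨{i}ᶜ, by simp [Finset.card_compl]⟩
  have hbij : Function.Bijective S := by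
    refine ⟨fun i j h => ?_, fun T => ?_⟩
    · have h := congrArg Subtype.val h
      exact Finset.singleton_injective (compl_injective h)
    · have : T.1ᶜ.card = 1 := by simp [Finset.card_compl, T.2]
      obtain ⟨i, hi⟩ := Finset.card_eq_one.1 this
      exact ⟨i, Subtype.ext (by simp [S, ← hi])⟩
  have hemb : ∀ i, ⇑((S i).1.orderEmbOfFin (S i).2) = i.succAbove := fun i => by
    rw [Finset.orderEmbOfFin_compl_singleton]; rfl
  have htop : ∀ i, top (S i) = i.succAbove (Fin.last b) := fun i => by rw [top, hemb]
  have htop1 : ∀ i : Fin (b + 1), top (S i.castSucc) = Fin.last (b + 1) := fun i => by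
    rw [htop, Fin.succAbove_castSucc_of_le _ _ (Fin.le_last i), Fin.succ_last]
  have htop2 : top (S (Fin.last (b + 1))) = (Fin.last b).castSucc := by
    rw [htop, Fin.succAbove_last]
  have hb1 : ∀ i : Fin (b + 1), before (S i.castSucc) = {i.castSucc} := fun i => by
    ext j
    simp only [before, htop1, Finset.mem_filter, Finset.mem_univ, true_and, S, Finset.mem_compl,
      Finset.mem_singleton, not_not]
    exact ⟨fun h => h.2, fun h => ⟨h ▸ Fin.castSucc_lt_last i, h⟩⟩
  have ha1 : ∀ i : Fin (b + 1), after (S i.castSucc) = ∅ := fun i => by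
    ext j; simp [after, htop1, Fin.le_last]
  have hb2 : before (S (Fin.last (b + 1))) = ∅ := by
    ext j
    simp only [before, htop2, Finset.mem_filter, Finset.mem_univ, true_and, S, Finset.mem_compl,
      Finset.mem_singleton, not_not, Finset.notMem_empty, iff_false, not_and]
    rintro h rfl
    exact absurd h (Fin.castSucc_lt_last _).not_gt
  have ha2 : after (S (Fin.last (b + 1))) = {Fin.last (b + 1)} := by
    ext j
    simp only [after, htop2, Finset.mem_filter, Finset.mem_univ, true_and, Finset.mem_singleton,
      Fin.ext_iff, Fin.lt_def, Fin.val_last, Fin.val_castSucc]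
    omega
  rw [← hbij.sum_comp (fun S => codSign Q S α • (word K v (before S) *
    TensorAlgebra.ι K (q (v ∘ S.1.orderEmbOfFin S.2)) * word K v (after S))),
    Fin.sum_univ_castSucc]
  congr 1
  · refine Finset.sum_congr rfl fun i _ => ?_
    have hc : ((S i.castSucc).1.erase (top (S i.castSucc))).filter (fun j => j < i.castSucc) =
        Finset.Iio i.castSucc := by
      ext j
      simp only [htop1, S, Finset.mem_filter, Finset.mem_erase, Finset.mem_compl,
        Finset.mem_singleton, Finset.mem_Iio, and_iff_right_iff_imp]
      exact fun h => ⟨(h.trans (Fin.castSucc_lt_last i)).ne, h.ne⟩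
    rw [codSign, hb1, ha1, hemb, tprod_pair]
    simp only [Finset.sum_singleton, hc, word_singleton, word_empty, mul_one]
    rfl
  · rw [codSign, hb2, ha2, hemb, tprod_pair, Fin.succAbove_last]
    simp only [Finset.sum_empty, add_zero, sgn_zero, word_singleton, word_empty, one_mul, one_smul]
    rfl

/-- A two-element index set is encoded as `j.castSucc < i.succ` with j ≤ i. The letter at `j` moves
right past the letters in between, and `q` passes all letters before `i.succ` except that at `j`. -/
theorem coder_tprod_binary {b : ℕ} (Q : Deg n) (q : MultilinearMap K (fun _ : Fin 2 => W) W)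
    (α : Fin (b + 2) → Deg n) (v : Fin (b + 2) → W) (hv : ∀ i, v i ∈ 𝒲 (α i)) :
    coder 𝒲 Q (a := 1) q (TensorAlgebra.tprod K W (b + 2) v) =
      ∑ i : Fin (b + 1), ∑ j ∈ Finset.Iic i,
        sgn ((∑ l ∈ Finset.Ioc j i, α l.castSucc ⬝ᵥ α j.castSucc) +
          ∑ l ∈ (Finset.Iic i).erase j, Q ⬝ᵥ α l.castSucc) •
        TensorAlgebra.tprod K W (b + 1) (j.castSucc.removeNth
          (Function.update v i.succ (q ![v j.castSucc, v i.succ]))) := by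
  rw [coder_tprod 𝒲 Q q α v hv, Finset.sum_sigma']
  have hlt : ∀ {i j : Fin (b + 1)}, j ≤ i → j.castSucc < i.succ := fun h =>
    lt_of_le_of_lt (Fin.castSucc_le_castSucc_iff.2 h) Fin.castSucc_lt_succ
  symm
  refine Finset.sum_bij (fun x hx => (⟨{x.2.castSucc, x.1.succ}, Finset.card_pair
    (hlt (by simpa using hx)).ne⟩ : {S : Finset (Fin (b + 2)) // S.card = 1 + 1})) ?_ ?_ ?_ ?_
  · intros; exact Finset.mem_univ _
  · rintro ⟨i, j⟩ hx ⟨i', j'⟩ hx' h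
    have hj : j ≤ i := by simpa using hx
    have hj' : j' ≤ i' := by simpa using hx'
    have h := congrArg Subtype.val h
    simp only [Finset.ext_iff, Finset.mem_insert, Finset.mem_singleton] at h
    have h1 := h j.castSucc
    have h2 := h i.succ
    have h3 := h j'.castSucc
    have h4 := h i'.succ
    simp only [Fin.ext_iff, Fin.val_castSucc, Fin.val_succ, Fin.le_def, true_or,
      or_true, true_iff, iff_true] at h1 h2 h3 h4 hj hj'
    obtain rfl : i = i' := by ext; omega
    obtain rfl : j = j' := by ext; omega
    rfl
  · rintro ⟨T, hT⟩ -
    obtain ⟨x, y, hxy, rfl⟩ : ∃ x y, x < y ∧ T = {x, y} := by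
      obtain ⟨x, y, hne, rfl⟩ := Finset.card_eq_two.1 hT
      rcases lt_or_gt_of_ne hne with h | h
      · exact ⟨x, y, h, rfl⟩
      · exact ⟨y, x, h, Finset.pair_comm _ _⟩
    obtain ⟨i, rfl⟩ := Fin.exists_succ_eq.2 (Fin.ne_zero_of_lt hxy)
    obtain ⟨j, rfl⟩ := Fin.exists_castSucc_eq.2 (Fin.ne_last_of_lt hxy)
    exact ⟨⟨i, j⟩, Finset.mem_sigma.2 ⟨Finset.mem_univ _,
      Finset.mem_Iic.2 (Fin.castSucc_lt_succ_iff.1 hxy)⟩, rfl⟩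
  · rintro ⟨i, j⟩ hx
    have hj : j ≤ i := by simpa using hx
    let S : {S : Finset (Fin (b + 2)) // S.card = 1 + 1} :=
      ⟨{j.castSucc, i.succ}, Finset.card_pair (hlt hj).ne⟩
    have hemb : ⇑(S.1.orderEmbOfFin S.2) = ![j.castSucc, i.succ] := by
      refine (Finset.orderEmbOfFin_unique S.2 (fun k => ?_) ?_).symm
      · fin_cases k <;> simp [S]
      · rw [Fin.strictMono_iff_lt_succ]
        intro k
        fin_cases k
        exact hlt hj
    have htop : top S = i.succ := by rw [top, hemb]; rfl
    have hbef : before S = ((Finset.Iic i).erase j).map Fin.castSuccEmb := by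
      ext l
      simp only [before, htop, S, Finset.mem_filter, Finset.mem_univ, true_and, Finset.mem_insert,
        Finset.mem_singleton, Finset.mem_map, Finset.mem_erase, Finset.mem_Iic,
        Fin.coe_castSuccEmb]
      constructor
      · rintro ⟨h1, h2⟩
        obtain ⟨k, rfl⟩ := Fin.exists_castSucc_eq.2 (Fin.ne_last_of_lt h1)
        refine ⟨k, ⟨fun h => h2 (Or.inl (by rw [h])), ?_⟩, rfl⟩
        exact Fin.castSucc_lt_succ_iff.1 h1
      · rintro ⟨k, ⟨h1, h2⟩, rfl⟩
        refine ⟨hlt h2, ?_⟩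
        rintro (h | h)
        · exact h1 (Fin.castSucc_injective _ h)
        · exact (hlt h2).ne h
    have haft : after S = Finset.Ioi i.succ := by ext; simp [after, htop]
    -- In increasing order, the indices other than `j` are those in front, then the place of `q`,
    -- then those behind; hence the product of words is one tensor with `q(…)` at the place of
    -- `i.succ`.
    have hcompl : ({j.castSucc}ᶜ : Finset (Fin (b + 2))) =
        before S ∪ ({i.succ} ∪ after S) := by
      ext l
      simp only [before, htop, haft, S, Finset.mem_filter, Finset.mem_univ, true_and,
        Finset.mem_insert, Finset.mem_singleton, Finset.mem_compl, Finset.mem_union,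
        Finset.mem_Ioi, Fin.ext_iff, Fin.lt_def, Fin.val_succ, Fin.val_castSucc]
      have := Fin.le_def.1 hj
      omega
    have hn1 : i.succ ∉ before S := by simp [before, htop]
    have hn2 : i.succ ∉ after S := by simp [after, htop]
    have hw : TensorAlgebra.tprod K W (b + 1) (j.castSucc.removeNth
        (Function.update v i.succ (q ![v j.castSucc, v i.succ]))) =
        word K v (before S) * TensorAlgebra.ι K (q ![v j.castSucc, v i.succ]) *
          word K v (after S) := by
      rw [← word_compl_singleton, hcompl, word_union, word_union, word_update_of_notMem _ hn1,
        word_update_of_notMem _ hn2, word_singleton, Function.update_self, mul_assoc]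
      · intro x hx y hy
        rw [haft, Finset.mem_Ioi] at hy
        rwa [Finset.mem_singleton.1 hx]
      · intro x hx y hy
        have h1 : x < i.succ := by
          simpa [htop] using (Finset.mem_filter.1 hx).2.1
        rcases Finset.mem_union.1 hy with hy | hy
        · rwa [Finset.mem_singleton.1 hy]
        · rw [haft, Finset.mem_Ioi] at hy
          exact h1.trans hy
    have hcod : codSign Q S α = sgn ((∑ l ∈ Finset.Ioc j i, α l.castSucc ⬝ᵥ α j.castSucc) +
          ∑ l ∈ (Finset.Iic i).erase j, Q ⬝ᵥ α l.castSucc) := by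
      have he : S.1.erase (top S) = {j.castSucc} := by
        rw [htop]
        ext l
        simp only [S, Finset.mem_erase, Finset.mem_insert, Finset.mem_singleton]
        exact ⟨fun h => h.2.resolve_right h.1, fun h => ⟨h ▸ (hlt hj).ne, Or.inl h⟩⟩
      have hf : Finset.Ioc j i = ((Finset.Iic i).erase j).filter (fun l => j < l) := by
        ext l
        simp only [Finset.mem_Ioc, Finset.mem_filter, Finset.mem_erase, Finset.mem_Iic]
        exact ⟨fun h => ⟨⟨h.1.ne', h.2⟩, h.1⟩, fun h => ⟨h.2, h.1.2⟩⟩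
      rw [codSign, he, hbef, Finset.sum_map, Finset.sum_map, hf, Finset.sum_filter]
      refine congrArg sgn (congrArg (· + _) (Finset.sum_congr rfl fun l _ => ?_))
      rw [Finset.filter_singleton]
      by_cases h : j < l
      · rw [if_pos h, if_pos (show j.castSucc < Fin.castSuccEmb l from h), Finset.sum_singleton]
        rfl
      · rw [if_neg h, if_neg (show ¬ j.castSucc < Fin.castSuccEmb l from h), Finset.sum_empty]
    have hv2 : v ∘ ![j.castSucc, i.succ] = ![v j.castSucc, v i.succ] := by
      funext k; fin_cases k <;> rfl
    change _ = codSign Q S α • (word K v (before S) *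
      TensorAlgebra.ι K (q (v ∘ S.1.orderEmbOfFin S.2)) * word K v (after S))
    rw [hw, hcod, hemb, hv2]

end CoderFormulas

/-! ### Sign exponents modulo 2 -/

section Parity

theorem two_eq_zero_zmod : (2 : ZMod 2) = 0 := rfl

/-- This distributes the global sign of the corestriction over the arguments, so that the exponents
below can be compared summand by summand. -/
theorem triangle_parity (b : ℕ) :
    ((b * (b + 1) / 2 : ℕ) : ZMod 2) = ∑ s : Fin (b + 1), ((b : ZMod 2) - (s.val : ZMod 2)) := by
  have h : ∑ s : Fin (b + 1), (b - s.val) = b * (b + 1) / 2 := by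
    have h1 := Finset.sum_range_reflect (fun k => k) (b + 1)
    rw [Finset.sum_range_id, Nat.add_sub_cancel, mul_comm] at h1
    rw [Fin.sum_univ_eq_sum_range (fun k => b - k), h1]
  rw [← h, Nat.cast_sum]
  exact Finset.sum_congr rfl fun s _ => Nat.cast_sub (Nat.lt_succ_iff.1 s.2)

theorem sum_ite_lt_one {R : Type*} [AddCommMonoidWithOne R] {m : ℕ} (i : Fin m) :
    (∑ s : Fin m, if s < i then (1 : R) else 0) = (i.val : R) := by
  rw [Finset.sum_ite, Finset.sum_const_zero, add_zero, Finset.sum_const]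
  have : Finset.univ.filter (fun s => s < i) = Finset.Iio i := by ext; simp
  rw [this, Fin.card_Iio, nsmul_one]

theorem val_succAbove_castSucc {b : ℕ} (i s : Fin (b + 1)) :
    ((i.castSucc.succAbove s).val : ZMod 2) = s.val + if s < i then 0 else 1 := by
  split_ifs with h
  · rw [Fin.succAbove_of_castSucc_lt _ _ (Fin.castSucc_lt_castSucc_iff.2 h)]; simp
  · rw [Fin.succAbove_castSucc_of_le _ _ (not_lt.1 h)]; simp

/-- Here `a s` stands for ⟨e₁, v_s⟩, and `a s - 1` for the same pairing after desuspension. -/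
theorem parity_last (b : ℕ) (a : Fin (b + 1) → ZMod 2) :
    (∑ s : Fin (b + 1), ((b : ZMod 2) + 1 - s.val) * a s) +
      (∑ s : Fin (b + 1), ((b : ZMod 2) - s.val) * (a s - 1)) +
      (∑ s : Fin (b + 1), (a s - 1)) + ((b * (b + 1) / 2 : ℕ) : ZMod 2) = (b : ZMod 2) + 1 := by
  have h1 : (b : ZMod 2) + 1 = ∑ s : Fin (b + 1), (1 : ZMod 2) := by simp
  rw [triangle_parity]
  conv_rhs => rw [h1]
  simp only [← Finset.sum_add_distrib]
  refine Finset.sum_congr rfl fun s _ => ?_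
  linear_combination (((b : ZMod 2) + 1 - s.val) * a s - 1) * two_eq_zero_zmod

/-- With v the vector taken out, `c` stands for ⟨e₁, v⟩ and `x s` for ⟨v, v_s⟩; the combination `x s
- c - a s + 1` is the pairing of the two desuspended degrees. -/
theorem parity_remove {b : ℕ} (i : Fin (b + 1)) (a x : Fin (b + 1) → ZMod 2) (c : ZMod 2) :
    (∑ s : Fin (b + 1), ((b : ZMod 2) + 1 - (i.castSucc.succAbove s).val) * a s) +
      (∑ s : Fin (b + 1), ((b : ZMod 2) - s.val) * (a s - 1)) +
      (∑ s : Fin (b + 1), if s < i then x s - c - a s + 1 else 0) +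
      ((b * (b + 1) / 2 : ℕ) : ZMod 2) =
    (∑ s : Fin (b + 1), if s < i then x s else 0) + (i.val : ZMod 2) * c + i.val := by
  rw [triangle_parity, ← sum_ite_lt_one, Finset.sum_mul]
  simp only [← Finset.sum_add_distrib, val_succAbove_castSucc]
  refine Finset.sum_congr rfl fun s _ => ?_
  split_ifs
  · linear_combination (((b : ZMod 2) - s.val) * a s - c) * two_eq_zero_zmod
  · linear_combination (((b : ZMod 2) - s.val) * a s) * two_eq_zero_zmod

/-- Notation as in `parity_remove`. The extra `c` at `s = i` appears because that slot now holds the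
bracket with the removed vector. -/
theorem parity_insert {b : ℕ} {i j : Fin (b + 1)} (hj : j ≤ i) (a x : Fin (b + 1) → ZMod 2)
    (c : ZMod 2) :
    (∑ s : Fin (b + 1), ((b : ZMod 2) + 1 - (j.castSucc.succAbove s).val) * a s) +
      (∑ s : Fin (b + 1), ((b : ZMod 2) - s.val) * (a s - 1 + if s = i then c else 0)) +
      (∑ s : Fin (b + 1), if ¬ s < j ∧ s < i then x s - a s - c + 1 else 0) +
      (∑ s : Fin (b + 1), if s < i then a s - 1 else 0) +
      ((b * (b + 1) / 2 : ℕ) : ZMod 2) =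
    (∑ s : Fin (b + 1), if ¬ s < j ∧ s < i then x s else 0) +
      ((b : ZMod 2) - j.val) * c + j.val := by
  -- The three sums give i + j + (b - i) = b + j, which is b - j modulo 2; in this form the
  -- coefficient of `c` splits over the arguments.
  have e : ((b : ZMod 2) - j.val) * c = (∑ s : Fin (b + 1), (if s < i then (1 : ZMod 2) else 0)) * c
      + (∑ s : Fin (b + 1), (if s < j then (1 : ZMod 2) else 0)) * c +
      ∑ s : Fin (b + 1), if s = i then ((b : ZMod 2) - s.val) * c else 0 := by
    rw [sum_ite_lt_one, sum_ite_lt_one, Finset.sum_ite_eq' Finset.univ i, if_pos (Finset.mem_univ _)]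
    linear_combination - (j.val : ZMod 2) * c * two_eq_zero_zmod
  rw [triangle_parity, e, ← sum_ite_lt_one (R := ZMod 2) j, Finset.sum_mul, Finset.sum_mul]
  simp only [← Finset.sum_add_distrib, val_succAbove_castSucc]
  refine Finset.sum_congr rfl fun s _ => ?_
  by_cases h1 : s < j
  · have h2 : s < i := h1.trans_le hj
    have h3 : s ≠ i := h2.ne
    simp only [h1, h2, h3, if_true, if_false, not_true, false_and]
    linear_combination (((b : ZMod 2) + 1 - s.val) * a s - 1 - c) * two_eq_zero_zmod
  · by_cases h2 : s < i
    · have h3 : s ≠ i := h2.ne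
      simp only [h1, h2, h3, if_true, if_false, not_false_iff, true_and]
      linear_combination (((b : ZMod 2) - s.val) * a s - c) * two_eq_zero_zmod
    · by_cases h3 : s = i
      · subst h3
        simp only [h1, lt_irrefl, if_true, if_false, not_false_iff, and_false]
        linear_combination (((b : ZMod 2) - s.val) * a s) * two_eq_zero_zmod
      · simp only [h1, h2, h3, if_false, not_false_iff, and_false]
        linear_combination (((b : ZMod 2) - s.val) * a s) * two_eq_zero_zmod

/-- Sums that skip one index are rewritten over the remaining arguments, the common index set needed
for the termwise parity comparison. -/
theorem sum_ite_succAbove {M : Type*} [AddCommMonoid M] {m : ℕ} (i : Fin (m + 1))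
    (P : Fin (m + 1) → Prop) [DecidablePred P] (hP : ¬ P i) (g : Fin (m + 1) → M) :
    (∑ l, if P l then g l else 0) =
      ∑ s, if P (i.succAbove s) then g (i.succAbove s) else 0 := by
  rw [Fin.sum_univ_succAbove _ i, if_neg hP, zero_add]

theorem succAbove_castSucc_lt_succ {b : ℕ} {i j : Fin (b + 1)} (hj : j ≤ i) (s : Fin (b + 1)) :
    j.castSucc.succAbove s < i.succ ↔ s < i := by
  rw [Fin.le_def] at hj
  by_cases h : s < j
  · rw [Fin.succAbove_of_castSucc_lt _ _ (Fin.castSucc_lt_castSucc_iff.2 h)]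
    rw [Fin.lt_def] at h
    simp only [Fin.lt_def, Fin.val_castSucc, Fin.val_succ]
    omega
  · rw [Fin.succAbove_castSucc_of_le _ _ (not_lt.1 h), Fin.succ_lt_succ_iff]

theorem castSucc_lt_succAbove_castSucc {b : ℕ} (j s : Fin (b + 1)) :
    j.castSucc < j.castSucc.succAbove s ↔ ¬ s < j := by
  rw [Fin.lt_succAbove_iff_le_castSucc, Fin.castSucc_le_castSucc_iff, not_lt]

theorem succAbove_castSucc_lt {b : ℕ} (j s : Fin (b + 1)) :
    j.castSucc.succAbove s < j.castSucc ↔ s < j := by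
  rw [Fin.succAbove_lt_iff_castSucc_lt, Fin.castSucc_lt_castSucc_iff]

theorem sum_Iio_castSucc {M : Type*} [AddCommMonoid M] {b : ℕ} (i : Fin (b + 1))
    (g : Fin (b + 2) → M) : ∑ l ∈ Finset.Iio i.castSucc, g l =
      ∑ s, if s < i then g (i.castSucc.succAbove s) else 0 := by
  rw [sum_Iio_eq_ite, sum_ite_succAbove i.castSucc (fun l => l < i.castSucc) (lt_irrefl _)]
  simp only [succAbove_castSucc_lt]

theorem sum_Ioc_castSucc {M : Type*} [AddCommMonoid M] {b : ℕ} {i j : Fin (b + 1)} (hj : j ≤ i)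
    (g : Fin (b + 2) → M) : ∑ l ∈ Finset.Ioc j i, g l.castSucc =
      ∑ s, if ¬ s < j ∧ s < i then g (j.castSucc.succAbove s) else 0 := by
  have h := sum_ite_succAbove j.castSucc (fun l => j.castSucc < l ∧ l < i.succ)
    (fun h => lt_irrefl _ h.1) g
  simp only [castSucc_lt_succAbove_castSucc, succAbove_castSucc_lt_succ hj] at h
  rw [← h, sum_Ioc_eq_ite]
  conv_rhs => rw [Fin.sum_univ_castSucc]
  simp [Fin.castSucc_lt_succ_iff, Fin.not_lt.2 (Fin.le_last _)]

theorem sum_Iic_erase_castSucc {M : Type*} [AddCommMonoid M] {b : ℕ} {i j : Fin (b + 1)}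
    (hj : j ≤ i) (g : Fin (b + 2) → M) : ∑ l ∈ (Finset.Iic i).erase j, g l.castSucc =
      ∑ s, if s < i then g (j.castSucc.succAbove s) else 0 := by
  have h := sum_ite_succAbove j.castSucc (fun l => l ≠ j.castSucc ∧ l < i.succ)
    (fun h => h.1 rfl) g
  simp only [succAbove_castSucc_lt_succ hj, ne_eq, Fin.succAbove_ne, not_false_iff, true_and] at h
  rw [← h, Fin.sum_univ_castSucc]
  have e : (Finset.Iic i).erase j = Finset.univ.filter (fun l => l ≠ j ∧ l ≤ i) := by
    ext; simp
  rw [e, Finset.sum_filter]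
  simp [Fin.castSucc_lt_succ_iff, Fin.not_lt.2 (Fin.le_last _)]

end Parity

/-! ### The stem bracket with π equals the explicit formula -/

section StemFormula

variable {K V : Type*} [Field K] [AddCommGroup V] [Module K V] {n : ℕ}
  {𝒱 : Deg n → Submodule K V} {π : MultilinearMap K (fun _ : Fin 2 => V) V}

theorem removeNth_update_br (hπ : IsLodayBracket 𝒱 π) {p : ℕ} (w : Fin (p + 1) → HVec 𝒱)
    (i j k : Fin (p + 1)) :
    (fun s => (i.removeNth (Function.update w j ((w k).br hπ (w j))) s).val) =
      i.removeNth (Function.update (fun i => (w i).val) j (π ![(w k).val, (w j).val])) := by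
  funext s
  simp only [Fin.removeNth]
  by_cases h : i.succAbove s = j
  · rw [h, Function.update_self, Function.update_self]
    rfl
  · rw [Function.update_of_ne h, Function.update_of_ne h]

variable [NeZero n]

theorem e₁_dotProduct_e₁ : e₁ n ⬝ᵥ e₁ n = 1 := by
  simp [e₁]

theorem mem_desusp (x : HVec 𝒱) : x.val ∈ desusp 𝒱 (x.deg - e₁ n) := by
  rw [desusp, sub_add_cancel]
  exact x.mem

/-- On the desuspension a weight 0 bracket has weight e₁. -/
theorem bracket_mem_desusp (hπ : IsLodayBracket 𝒱 π) {γ δ : Deg n} {x y : V}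
    (hx : x ∈ desusp 𝒱 γ) (hy : y ∈ desusp 𝒱 δ) :
    π ![x, y] ∈ desusp 𝒱 (e₁ n + γ + δ) := by
  have := hπ.bracket_mem hx hy
  rw [desusp]
  convert this using 2
  abel

variable [DirectSum.Decomposition 𝒱]

theorem corestr_apply {a : ℕ} (f : MultilinearMap K (fun _ : Fin (a + 1) => V) V)
    {γ : Fin (a + 1) → Deg n} {x : Fin (a + 1) → V} (hx : ∀ i, x i ∈ desusp 𝒱 (γ i)) :
    corestr 𝒱 f x = (sgn ((a * (a + 1) / 2 : ℕ) : ℤ) * sgn (suspExp γ)) • f x := by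
  rw [corestr, _root_.smul_apply, signTwist_apply _ _ _ γ x hx, smul_smul]

theorem corestr_mem {A : Deg n} {a : ℕ} {f : MultilinearMap K (fun _ : Fin (a + 1) => V) V}
    (hf : f ∈ weightMaps 𝒱 A (a + 1)) {γ : Fin (a + 1) → Deg n} {x : Fin (a + 1) → V}
    (hx : ∀ i, x i ∈ desusp 𝒱 (γ i)) :
    corestr 𝒱 f x ∈ desusp 𝒱 (A + (a : ℤ) • e₁ n + ∑ i, γ i) := by
  rw [corestr_apply f hx]
  refine zsmul_mem ?_ _
  have h := hf _ x hx
  rw [Finset.sum_add_distrib, Finset.sum_const, Finset.card_univ, Fintype.card_fin] at h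
  have e : A + (a : ℤ) • e₁ n + ∑ i, γ i + e₁ n = A + (∑ i, γ i + (a + 1) • e₁ n) := by
    module
  rw [desusp, e]
  exact h

theorem phi_tprod_self (A : Deg n) {a : ℕ} (f : MultilinearMap K (fun _ : Fin (a + 1) => V) V)
    {γ : Fin (a + 1) → Deg n} {x : Fin (a + 1) → V} (hx : ∀ i, x i ∈ desusp 𝒱 (γ i)) :
    phi 𝒱 A f (TensorAlgebra.tprod K V (a + 1) x) =
      (sgn ((a * (a + 1) / 2 : ℕ) : ℤ) * sgn (suspExp γ)) • TensorAlgebra.ι K (f x) := by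
  rw [phi, coder_tprod_self _ _ _ γ x hx, corestr_apply f hx, map_zsmul]

/-- For a = 1 the global sign contributes the exponent 1, and the suspension exponent involves only
the first vector. -/
theorem phi_tprod_pair {γ δ : Deg n} {x y : V} (hx : x ∈ desusp 𝒱 γ) (hy : y ∈ desusp 𝒱 δ) :
    phi 𝒱 0 (a := 1) π (TensorAlgebra.tprod K V 2 ![x, y]) =
      sgn (1 + e₁ n ⬝ᵥ γ) • TensorAlgebra.ι K (π ![x, y]) := by
  have h := phi_tprod_self (𝒱 := 𝒱) 0 (a := 1) π (γ := ![γ, δ]) (x := ![x, y])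
    (by intro i; fin_cases i <;> simpa)
  refine h.trans ?_
  rw [sgn_add]
  simp [suspExp]

/-- The inner coderivation shortens the word to two letters, on which that of π is just its
corestriction. -/
theorem ιInv_phi_phi_left (B : Deg n) {b : ℕ} {f : MultilinearMap K (fun _ : Fin (b + 1) => V) V}
    (hf : f ∈ weightMaps 𝒱 B (b + 1)) {β : Fin (b + 2) → Deg n} {v : Fin (b + 2) → V}
    (hv : ∀ i, v i ∈ desusp 𝒱 (β i)) :
    TensorAlgebra.ιInv (phi 𝒱 0 (a := 1) π (phi 𝒱 B f (TensorAlgebra.tprod K V (b + 2) v))) =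
      (∑ i : Fin (b + 1), sgn ((∑ j ∈ Finset.Iio i.castSucc, β i.castSucc ⬝ᵥ β j) +
        (B + (b : ℤ) • e₁ n) ⬝ᵥ β i.castSucc + (1 + e₁ n ⬝ᵥ β i.castSucc) +
        ((b * (b + 1) / 2 : ℕ) : ℤ) + suspExp (i.castSucc.removeNth β)) •
        π ![v i.castSucc, f (i.castSucc.removeNth v)]) +
      sgn (1 + e₁ n ⬝ᵥ (B + (b : ℤ) • e₁ n + ∑ i : Fin (b + 1), β i.castSucc) +
        ((b * (b + 1) / 2 : ℕ) : ℤ) + suspExp (Fin.init β)) •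
        π ![f (Fin.init v), v (Fin.last (b + 1))] := by
  have hr : ∀ (i : Fin (b + 2)) (s : Fin (b + 1)), i.removeNth v s ∈ desusp 𝒱 (i.removeNth β s) := fun i s => hv _
  have hi : ∀ s, Fin.init v s ∈ desusp 𝒱 (Fin.init β s) := fun s => hv _
  have hc : ∀ i : Fin (b + 2), corestr 𝒱 f (i.removeNth v) ∈ desusp 𝒱 _ := fun i => corestr_mem hf (hr i)
  rw [phi.eq_1 𝒱 B, coder_tprod_succ _ _ _ β v hv, map_add, map_sum, map_add, map_sum]
  congr 1
  · refine Finset.sum_congr rfl fun i _ => ?_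
    rw [map_zsmul, phi_tprod_pair (hv _) (hc _), map_zsmul, map_zsmul,
      TensorAlgebra.ι_leftInverse, corestr_apply f (hr _), ← adMap_apply, map_zsmul, adMap_apply,
      smul_smul, smul_smul]
    simp only [sgn_add]
    congr 1
    ring
  · rw [phi_tprod_pair (corestr_mem hf hi) (hv _), map_zsmul,
      TensorAlgebra.ι_leftInverse, corestr_apply f hi, ← coadMap_apply, map_zsmul, coadMap_apply,
      smul_smul]
    simp only [sgn_add, ← mul_assoc]
    rfl

/-- The inner coderivation merges two letters, leaving b + 1 of them, on which that of `f` is just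
its corestriction. -/
theorem ιInv_phi_phi_right (hπ : IsLodayBracket 𝒱 π) (B : Deg n) {b : ℕ}
    (f : MultilinearMap K (fun _ : Fin (b + 1) => V) V)
    {β : Fin (b + 2) → Deg n} {v : Fin (b + 2) → V} (hv : ∀ i, v i ∈ desusp 𝒱 (β i)) :
    TensorAlgebra.ιInv (phi 𝒱 B f (phi 𝒱 0 (a := 1) π (TensorAlgebra.tprod K V (b + 2) v))) =
      ∑ i : Fin (b + 1), ∑ j ∈ Finset.Iic i,
        sgn ((∑ l ∈ Finset.Ioc j i, β l.castSucc ⬝ᵥ β j.castSucc) +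
          (∑ l ∈ (Finset.Iic i).erase j, e₁ n ⬝ᵥ β l.castSucc) + (1 + e₁ n ⬝ᵥ β j.castSucc) +
          ((b * (b + 1) / 2 : ℕ) : ℤ) + suspExp (j.castSucc.removeNth
            (Function.update β i.succ (e₁ n + β j.castSucc + β i.succ)))) •
        f (j.castSucc.removeNth
          (Function.update v i.succ (π ![v j.castSucc, v i.succ]))) := by
  have hc : ∀ i j : Fin (b + 1), corestr 𝒱 (a := 1) π ![v j.castSucc, v i.succ] =
      sgn (1 + e₁ n ⬝ᵥ β j.castSucc) • π ![v j.castSucc, v i.succ] := fun i j => by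
    have h := corestr_apply (𝒱 := 𝒱) (a := 1) π (γ := ![β j.castSucc, β i.succ])
      (x := ![v j.castSucc, v i.succ]) (by intro k; fin_cases k <;> simp [hv])
    refine h.trans ?_
    rw [sgn_add]
    simp [suspExp]
  have hm : ∀ (i j : Fin (b + 1)) s, j.castSucc.removeNth
      (Function.update v i.succ (π ![v j.castSucc, v i.succ])) s ∈
      desusp 𝒱 (j.castSucc.removeNth
        (Function.update β i.succ (e₁ n + β j.castSucc + β i.succ)) s) := fun i j s => by
    simp only [Fin.removeNth]
    by_cases h : j.castSucc.succAbove s = i.succ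
    · rw [h, Function.update_self, Function.update_self]
      exact bracket_mem_desusp hπ (hv _) (hv _)
    · rw [Function.update_of_ne h, Function.update_of_ne h]
      exact hv _
  -- Since j ≤ i, the slot `i.succ` survives the removal of `j`, so the tensor is linear in the
  -- bracket placed there and its sign can be pulled out.
  have hlin : ∀ (i j : Fin (b + 1)), j ≤ i → ∀ (c : ℤ) (x : V),
      TensorAlgebra.tprod K V (b + 1) (j.castSucc.removeNth (Function.update v i.succ (c • x))) =
      c • TensorAlgebra.tprod K V (b + 1) (j.castSucc.removeNth (Function.update v i.succ x)) :=
    fun i j hj c x => by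
      have e : j.castSucc.succAbove i = i.succ := Fin.succAbove_castSucc_of_le _ _ hj
      have e2 : ∀ y : V, j.castSucc.removeNth (Function.update v i.succ y) =
          Function.update (j.castSucc.removeNth v) i y := fun y => by
        rw [← e, Fin.removeNth_update_succAbove]
      rw [e2, e2, ← Int.cast_smul_eq_zsmul K, MultilinearMap.map_update_smul,
        Int.cast_smul_eq_zsmul]
  rw [phi.eq_1 𝒱 0, coder_tprod_binary _ _ _ β v hv, map_sum, map_sum]
  refine Finset.sum_congr rfl fun i _ => ?_
  rw [map_sum, map_sum]
  refine Finset.sum_congr rfl fun j hj => ?_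
  rw [hc, hlin i j (Finset.mem_Iic.1 hj), smul_smul, map_zsmul, phi_tprod_self B f (hm i j),
    smul_smul, map_zsmul, TensorAlgebra.ι_leftInverse]
  simp only [sgn_add, ← mul_assoc, zero_add, Nat.cast_one, one_smul]

theorem suspExp_succAbove {b : ℕ} (i : Fin (b + 1)) (α : Fin (b + 2) → Deg n) :
    (suspExp α : ZMod 2) = ((b : ZMod 2) + 1 - i.val) * (e₁ n ⬝ᵥ α i.castSucc : ℤ) +
      ∑ s : Fin (b + 1), ((b : ZMod 2) + 1 - (i.castSucc.succAbove s).val) *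
        (e₁ n ⬝ᵥ α (i.castSucc.succAbove s) : ℤ) := by
  have e : (b : ZMod 2) + 2 - 1 = b + 1 := by ring
  rw [suspExp, Fin.sum_univ_succAbove _ i.castSucc]
  push_cast
  simp only [e]
  rfl

/-- The last vector drops out, as its coefficient is 0. -/
theorem suspExp_castSucc {b : ℕ} (α : Fin (b + 2) → Deg n) :
    (suspExp α : ZMod 2) = ∑ s : Fin (b + 1), ((b : ZMod 2) + 1 - s.val) *
      (e₁ n ⬝ᵥ α s.castSucc : ℤ) := by
  have e : (b : ZMod 2) + 2 - 1 = b + 1 := by ring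
  rw [suspExp, Fin.sum_univ_castSucc]
  push_cast
  simp [e]

theorem suspExp_cast {b : ℕ} (α : Fin (b + 1) → Deg n) :
    (suspExp α : ZMod 2) = ∑ s : Fin (b + 1), ((b : ZMod 2) - s.val) * (e₁ n ⬝ᵥ α s : ℤ) := by
  rw [suspExp]
  push_cast
  simp

/-- The factors are the prefactor of the stem bracket, the sign of the suspensions in φ⁻¹, and the
sign of the composite. Modulo 2 this is `parity_last`, the weight `B` occurring twice. -/
theorem stem_sign_last (B : Deg n) {b : ℕ} (α : Fin (b + 2) → Deg n) :
    sgn (1 + e₁ n ⬝ᵥ ((b : ℤ) • e₁ n + B)) * (sgn (suspExp α) *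
      sgn (1 + e₁ n ⬝ᵥ (B + (b : ℤ) • e₁ n + ∑ i : Fin (b + 1), (α i.castSucc - e₁ n)) +
        ((b * (b + 1) / 2 : ℕ) : ℤ) + suspExp (Fin.init fun i => α i - e₁ n))) =
      sgn ((b + 1 : ℕ) : ℤ) := by
  rw [← sgn_add, ← sgn_add]
  refine sgn_congr ?_
  have h := parity_last b fun s => ((e₁ n ⬝ᵥ α s.castSucc : ℤ) : ZMod 2)
  simp only [Int.cast_add, suspExp_castSucc, suspExp_cast, Fin.init, dotProduct_sub,
    dotProduct_add, dotProduct_sum, dotProduct_smul, e₁_dotProduct_e₁, smul_eq_mul, mul_one,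
    Int.cast_sub, Int.cast_sum, Int.cast_one, Int.cast_natCast, Nat.cast_add, Nat.cast_one]
  linear_combination h + (1 + (b : ZMod 2) + (e₁ n ⬝ᵥ B : ℤ)) * two_eq_zero_zmod

theorem stem_sign_remove (B : Deg n) {b : ℕ} (α : Fin (b + 2) → Deg n) (i : Fin (b + 1)) :
    sgn (1 + e₁ n ⬝ᵥ ((b : ℤ) • e₁ n + B)) * (sgn (suspExp α) *
      sgn ((∑ j ∈ Finset.Iio i.castSucc, (α i.castSucc - e₁ n) ⬝ᵥ (α j - e₁ n)) +
        (B + (b : ℤ) • e₁ n) ⬝ᵥ (α i.castSucc - e₁ n) +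
        (1 + e₁ n ⬝ᵥ (α i.castSucc - e₁ n)) + ((b * (b + 1) / 2 : ℕ) : ℤ) +
        suspExp (i.castSucc.removeNth fun i => α i - e₁ n))) =
      -(sgn (i.val : ℤ) *
        sgn ((B + ∑ l ∈ Finset.Iio i.castSucc, α l) ⬝ᵥ α i.castSucc)) := by
  have e : ∀ k, -sgn k = sgn (1 + k) := fun k => by simp [sgn_add]
  rw [← sgn_add, ← sgn_add, ← sgn_add, e]
  refine sgn_congr ?_
  have h := parity_remove i
    (fun s => ((e₁ n ⬝ᵥ α (i.castSucc.succAbove s) : ℤ) : ZMod 2))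
    (fun s => ((α i.castSucc ⬝ᵥ α (i.castSucc.succAbove s) : ℤ) : ZMod 2))
    ((e₁ n ⬝ᵥ α i.castSucc : ℤ) : ZMod 2)
  have c : (B + ∑ l ∈ Finset.Iio i.castSucc, α l) ⬝ᵥ α i.castSucc =
      B ⬝ᵥ α i.castSucc + ∑ l ∈ Finset.Iio i.castSucc, α i.castSucc ⬝ᵥ α l := by
    rw [add_dotProduct, dotProduct_comm (∑ l ∈ Finset.Iio i.castSucc, α l), dotProduct_sum]
  have c2 : ∀ l, (α i.castSucc - e₁ n) ⬝ᵥ (α l - e₁ n) =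
      α i.castSucc ⬝ᵥ α l - e₁ n ⬝ᵥ α i.castSucc - e₁ n ⬝ᵥ α l + 1 := by
    intro l
    rw [sub_dotProduct, dotProduct_sub, dotProduct_sub, dotProduct_comm _ (e₁ n),
      e₁_dotProduct_e₁]
    ring
  have c3 : (B + (b : ℤ) • e₁ n) ⬝ᵥ (α i.castSucc - e₁ n) =
      B ⬝ᵥ α i.castSucc - e₁ n ⬝ᵥ B + b * (e₁ n ⬝ᵥ α i.castSucc - 1) := by
    rw [add_dotProduct, smul_dotProduct, dotProduct_sub, dotProduct_sub, dotProduct_comm B (e₁ n),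
      e₁_dotProduct_e₁, smul_eq_mul]
  simp only [c, c2, c3]
  rw [sum_Iio_castSucc i (fun l => α i.castSucc ⬝ᵥ α l - e₁ n ⬝ᵥ α i.castSucc - e₁ n ⬝ᵥ α l + 1),
    sum_Iio_castSucc i (fun l => α i.castSucc ⬝ᵥ α l)]
  simp only [Int.cast_add, suspExp_succAbove i, suspExp_cast, Fin.removeNth, dotProduct_sub,
    dotProduct_add, dotProduct_smul, e₁_dotProduct_e₁, smul_eq_mul, mul_one, Int.cast_ite,
    Int.cast_sub, Int.cast_sum, Int.cast_one, Int.cast_mul, Int.cast_natCast, Int.cast_zero]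
  linear_combination h + ((b : ZMod 2) + 1) * (e₁ n ⬝ᵥ α i.castSucc : ℤ) * two_eq_zero_zmod

/-- The additional factor is the Koszul sign of the graded commutator; the minus sign in the result
cancels the one in front of the second composite. -/
theorem stem_sign_insert (B : Deg n) {b : ℕ} (α : Fin (b + 2) → Deg n) {i j : Fin (b + 1)}
    (hj : j ≤ i) :
    sgn (1 + e₁ n ⬝ᵥ ((b : ℤ) • e₁ n + B)) * (sgn (suspExp α) *
      (sgn (e₁ n ⬝ᵥ (B + (b : ℤ) • e₁ n)) *
      sgn ((∑ l ∈ Finset.Ioc j i, (α l.castSucc - e₁ n) ⬝ᵥ (α j.castSucc - e₁ n)) +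
        (∑ l ∈ (Finset.Iic i).erase j, e₁ n ⬝ᵥ (α l.castSucc - e₁ n)) +
        (1 + e₁ n ⬝ᵥ (α j.castSucc - e₁ n)) + ((b * (b + 1) / 2 : ℕ) : ℤ) +
        suspExp (j.castSucc.removeNth (Function.update (fun i => α i - e₁ n) i.succ
          (e₁ n + (α j.castSucc - e₁ n) + (α i.succ - e₁ n))))))) =
      -(sgn (j.val : ℤ) * sgn (α j.castSucc ⬝ᵥ ∑ l ∈ Finset.Ioc j i, α l.castSucc)) := by
  have e : ∀ k, -sgn k = sgn (1 + k) := fun k => by simp [sgn_add]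
  rw [← sgn_add, ← sgn_add, ← sgn_add, ← sgn_add, e]
  refine sgn_congr ?_
  have h := parity_insert hj
    (fun s => ((e₁ n ⬝ᵥ α (j.castSucc.succAbove s) : ℤ) : ZMod 2))
    (fun s => ((α j.castSucc ⬝ᵥ α (j.castSucc.succAbove s) : ℤ) : ZMod 2))
    ((e₁ n ⬝ᵥ α j.castSucc : ℤ) : ZMod 2)
  have e1 : j.castSucc.succAbove i = i.succ := Fin.succAbove_castSucc_of_le _ _ hj
  have e2 : ∀ s, e₁ n ⬝ᵥ j.castSucc.removeNth (Function.update (fun i => α i - e₁ n) i.succ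
      (e₁ n + (α j.castSucc - e₁ n) + (α i.succ - e₁ n))) s =
      e₁ n ⬝ᵥ α (j.castSucc.succAbove s) - 1 + if s = i then e₁ n ⬝ᵥ α j.castSucc else 0 := by
    intro s
    rw [← e1, Fin.removeNth_update_succAbove]
    by_cases hs : s = i
    · subst hs
      rw [Function.update_self, if_pos rfl]
      simp only [dotProduct_add, dotProduct_sub, e₁_dotProduct_e₁]
      ring
    · rw [Function.update_of_ne hs, if_neg hs, Fin.removeNth, dotProduct_sub, e₁_dotProduct_e₁,
        add_zero]
  have c : ∀ l : Fin (b + 1), (α l.castSucc - e₁ n) ⬝ᵥ (α j.castSucc - e₁ n) =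
      α j.castSucc ⬝ᵥ α l.castSucc - e₁ n ⬝ᵥ α l.castSucc - e₁ n ⬝ᵥ α j.castSucc + 1 := by
    intro l
    rw [sub_dotProduct, dotProduct_sub, dotProduct_sub, dotProduct_comm _ (e₁ n),
      dotProduct_comm (α l.castSucc), e₁_dotProduct_e₁]
    ring
  simp only [c]
  rw [sum_Ioc_castSucc hj (fun l => α j.castSucc ⬝ᵥ α l - e₁ n ⬝ᵥ α l - e₁ n ⬝ᵥ α j.castSucc + 1),
    sum_Iic_erase_castSucc hj (fun l => e₁ n ⬝ᵥ (α l - e₁ n)), dotProduct_sum,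
    sum_Ioc_castSucc hj (fun l => α j.castSucc ⬝ᵥ α l)]
  simp only [Int.cast_add, suspExp_succAbove j, suspExp_cast, e2, dotProduct_sub, Int.cast_ite,
    dotProduct_add, dotProduct_smul, e₁_dotProduct_e₁, smul_eq_mul, mul_one,
    Int.cast_sub, Int.cast_sum, Int.cast_one, Int.cast_natCast, Int.cast_zero]
  linear_combination h + ((b : ZMod 2) + (b - j.val + 1) * (e₁ n ⬝ᵥ α j.castSucc : ℤ) +
    (e₁ n ⬝ᵥ B : ℤ)) * two_eq_zero_zmod

/-- The stem bracket with a Loday bracket is given by the explicit formula. -/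
theorem stemBracket_apply (hπ : IsLodayBracket 𝒱 π) (B : Deg n) {b : ℕ}
    {f : MultilinearMap K (fun _ : Fin (b + 1) => V) V} (hf : f ∈ weightMaps 𝒱 B (b + 1))
    (w : Fin (b + 2) → HVec 𝒱) :
    stemBracket 𝒱 0 B (a := 1) (b := b) π f (fun i => (w i).val) =
      explicitCobd hπ (p := b + 1) B (toHCochain 𝒱 f) w := by
  have hL := ιInv_phi_phi_left (π := π) B hf (fun i => mem_desusp (w i))
  have hR := ιInv_phi_phi_right hπ B f (fun i => mem_desusp (w i))
  have h0 : stemBracket 𝒱 0 B (a := 1) (b := b) π f (fun i => (w i).val) =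
      sgn (1 + e₁ n ⬝ᵥ ((b : ℤ) • e₁ n + B)) • sgn (suspExp fun i => (w i).deg) •
        (TensorAlgebra.ιInv (phi 𝒱 0 (a := 1) π (phi 𝒱 B f
          (TensorAlgebra.tprod K V (b + 2) fun i => (w i).val))) -
        sgn (e₁ n ⬝ᵥ (B + (b : ℤ) • e₁ n)) •
          TensorAlgebra.ιInv (phi 𝒱 B f (phi 𝒱 0 (a := 1) π
          (TensorAlgebra.tprod K V (b + 2) fun i => (w i).val)))) := by
    rw [stemBracket, _root_.smul_apply, phiInv,
      signTwist_apply 𝒱 _ _ (fun i => (w i).deg) _ fun i => (w i).mem]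
    simp only [LinearMap.compMultilinearMap_apply, LinearMap.comp_apply, LinearMap.sub_apply,
      map_sub, LinearMap.smul_apply, map_zsmul, Nat.cast_one, one_smul, zero_add]
  rw [h0, hL, hR, explicitCobd]
  simp only [smul_sub, smul_add, Finset.smul_sum, smul_smul, stem_sign_last, stem_sign_remove]
  -- This sign identity needs j ≤ i, so it can only be used once the summation index is known to lie
  -- in the triangle.
  have hI : ∀ (i : Fin (b + 1)), ∀ j ∈ Finset.Iic i, _ = _ := fun i j hj =>
    stem_sign_insert B (fun i => (w i).deg) (Finset.mem_Iic.1 hj)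
  simp only [neg_smul, Finset.sum_neg_distrib]
  rw [neg_add_eq_sub, sub_eq_add_neg (_ - _)]
  refine congrArg₂ (· + ·) rfl ?_
  rw [← Finset.sum_neg_distrib]
  refine Finset.sum_congr rfl fun i _ => ?_
  rw [← Finset.sum_neg_distrib]
  refine Finset.sum_congr rfl fun j hj => ?_
  rw [hI i j hj, neg_smul, neg_neg, toHCochain, removeNth_update_br]

end StemFormula

/-! ### The operator on M(V), its square, and the nongraded case -/

section Differential

variable {K V : Type*} [Field K] [AddCommGroup V] [Module K V] {n : ℕ}
  {𝒱 : Deg n → Submodule K V} {π : MultilinearMap K (fun _ : Fin 2 => V) V}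

theorem insSum_smul (hπ : IsLodayBracket 𝒱 π) (h : HVec 𝒱) (c : K) :
    ∀ {p : ℕ} (f : HCochain 𝒱 p), insSum hπ h p (c • f) = c • insSum hπ h p f
  | 0, f => by simp [insSum]
  | p + 1, f => by
    funext u
    refine Fin.consCases (fun x u => ?_) u
    have e : contract x (c • f) = c • contract x f := rfl
    rw [Pi.smul_apply, insSum_cons, insSum_cons, e, insSum_smul]
    simp only [Pi.smul_apply, smul_add, smul_comm c]

theorem lieDer_smul (hπ : IsLodayBracket 𝒱 π) (h : HVec 𝒱) (B : Deg n) (c : K) {p : ℕ}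
    (f : HCochain 𝒱 p) : lieDer hπ h B (c • f) = c • lieDer hπ h B f := by
  funext u
  simp only [lieDer_apply, insSum_smul, Pi.smul_apply, map_smul, smul_sub, smul_comm c]

theorem cobd_smul (hπ : IsLodayBracket 𝒱 π) (c : K) :
    ∀ {p : ℕ} (B : Deg n) (f : HCochain 𝒱 p), cobd hπ p B (c • f) = c • cobd hπ p B f
  | 0, B, f => by
    funext u
    simp only [cobd_zero, Pi.smul_apply, map_smul]
  | p + 1, B, f => by
    funext u
    refine Fin.consCases (fun x u => ?_) u
    have e : contract x (c • f) = c • contract x f := rfl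
    refine (congrFun (contract_cobd hπ B (c • f) x) u).trans ?_
    rw [e, lieDer_smul, cobd_smul, ← smul_neg, ← smul_sub]
    rfl

theorem mem_weightMaps_iff {B : Deg n} {p : ℕ} {f : MultilinearMap K (fun _ : Fin p => V) V} :
    f ∈ weightMaps 𝒱 B p ↔ ∀ w, toHCochain 𝒱 f w ∈ 𝒱 (B + ∑ i, (w i).deg) :=
  ⟨fun hf w => hf _ _ fun i => (w i).mem, fun hf α v hv => hf fun i => ⟨α i, v i, hv i⟩⟩

variable [DirectSum.Decomposition 𝒱]

/-- Decompose every argument into homogeneous components and expand by multilinearity. -/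
theorem toHCochain_injective {p : ℕ} : Function.Injective
    (toHCochain 𝒱 : MultilinearMap K (fun _ : Fin p => V) V → HCochain 𝒱 p) := by
  classical
  intro f g h
  ext v
  have e : v = fun i => ∑ α ∈ (DirectSum.decompose 𝒱 (v i)).support,
      (DirectSum.decompose 𝒱 (v i) α : V) :=
    funext fun i => (DirectSum.sum_support_decompose 𝒱 (v i)).symm
  rw [e, MultilinearMap.map_sum_finset, MultilinearMap.map_sum_finset]
  refine Finset.sum_congr rfl fun r _ => ?_
  exact congrFun h fun i => ⟨r i, _, (DirectSum.decompose 𝒱 (v i) (r i)).2⟩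

variable [NeZero n]

/-- The operator `v ↦ {v, -}` on `0`-cochains, and `[π, -]^⊗` on all the others. -/
def diffFun (𝒱 : Deg n → Submodule K V) [DirectSum.Decomposition 𝒱]
    (π : MultilinearMap K (fun _ : Fin 2 => V) V) (B : Deg n) :
    (p : ℕ) → MultilinearMap K (fun _ : Fin p => V) V →
      MultilinearMap K (fun _ : Fin (p + 1) => V) V
  | 0, f => π.curryLeft (f ![])
  | b + 1, f => stemBracket 𝒱 0 B (a := 1) (b := b) π f

/-- The bridge between the two descriptions: everything proved for the recursive coboundary now
holds for the stem bracket. -/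
theorem toHCochain_diffFun (hπ : IsLodayBracket 𝒱 π) (B : Deg n) :
    ∀ {p : ℕ} {f : MultilinearMap K (fun _ : Fin p => V) V}, f ∈ weightMaps 𝒱 B p →
      toHCochain 𝒱 (diffFun 𝒱 π B p f) = cobd hπ p B (toHCochain 𝒱 f)
  | 0, f, _ => by
    funext w
    rw [cobd_zero, coadMap_apply, toHCochain, toHCochain, diffFun, MultilinearMap.curryLeft_apply]
    congr 1
    funext k
    refine Fin.cases ?_ (fun k => ?_) k
    · exact congrArg f (Subsingleton.elim _ _)
    · rw [Subsingleton.elim k 0]; rfl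
  | b + 1, f, hf => by
    funext w
    rw [cobd_eq_explicitCobd]
    exact stemBracket_apply hπ B hf w

theorem diffFun_mem (hπ : IsLodayBracket 𝒱 π) {B : Deg n} {p : ℕ}
    {f : MultilinearMap K (fun _ : Fin p => V) V} (hf : f ∈ weightMaps 𝒱 B p) :
    diffFun 𝒱 π B p f ∈ weightMaps 𝒱 B (p + 1) := by
  rw [mem_weightMaps_iff, toHCochain_diffFun hπ B hf]
  exact cobd_mem hπ B (mem_weightMaps_iff.1 hf)

/-- The homogeneous components of the coboundary operator. -/
def diff (hπ : IsLodayBracket 𝒱 π) (B : Deg n) (p : ℕ) :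
    weightMaps 𝒱 B p →ₗ[K] weightMaps 𝒱 B (p + 1) where
  toFun f := ⟨diffFun 𝒱 π B p f.1, diffFun_mem hπ f.2⟩
  map_add' f g := by
    -- Linearity of the stem bracket in `f` is read off from that of `cobd`.
    refine Subtype.ext (toHCochain_injective (𝒱 := 𝒱) ?_)
    change toHCochain 𝒱 (diffFun 𝒱 π B p (f + g).1) =
      toHCochain 𝒱 (diffFun 𝒱 π B p f.1) + toHCochain 𝒱 (diffFun 𝒱 π B p g.1)
    rw [toHCochain_diffFun hπ B f.2, toHCochain_diffFun hπ B g.2,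
      toHCochain_diffFun hπ B (f + g).2, ← map_add]
    rfl
  map_smul' c f := by
    refine Subtype.ext (toHCochain_injective (𝒱 := 𝒱) ?_)
    change toHCochain 𝒱 (diffFun 𝒱 π B p (c • f).1) =
      c • toHCochain 𝒱 (diffFun 𝒱 π B p f.1)
    rw [toHCochain_diffFun hπ B f.2, toHCochain_diffFun hπ B (c • f).2, ← cobd_smul]
    rfl

theorem toHCochain_diff (hπ : IsLodayBracket 𝒱 π) {B : Deg n} {p : ℕ} (f : weightMaps 𝒱 B p) :
    toHCochain 𝒱 (diff hπ B p f).1 = cobd hπ p B (toHCochain 𝒱 f.1) :=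
  toHCochain_diffFun hπ B f.2

theorem diff_diff (hπ : IsLodayBracket 𝒱 π) {B : Deg n} {p : ℕ} (f : weightMaps 𝒱 B p) :
    diff hπ B (p + 1) (diff hπ B p f) = 0 := by
  refine Subtype.ext (toHCochain_injective (𝒱 := 𝒱) ?_)
  rw [toHCochain_diff, toHCochain_diff, cobd_cobd hπ B _ (isCochain_toHCochain f.2)]
  rfl

theorem diff_apply (hπ : IsLodayBracket 𝒱 π) {B : Deg n} {p : ℕ} (f : weightMaps 𝒱 B p)
    {α : Fin (p + 1) → Deg n} {v : Fin (p + 1) → V} (hv : ∀ i, v i ∈ 𝒱 (α i)) :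
    (diff hπ B p f).1 v = sgn (p : ℤ) • π ![f.1 (Fin.init v), v (Fin.last p)] -
      (∑ i : Fin p, (sgn (i.val : ℤ) *
        sgn ((B + ∑ l ∈ Finset.Iio i.castSucc, α l) ⬝ᵥ α i.castSucc)) •
        π ![v i.castSucc, f.1 (i.castSucc.removeNth v)]) +
      ∑ i : Fin p, ∑ j ∈ Finset.Iic i, (sgn (j.val : ℤ) *
        sgn (α j.castSucc ⬝ᵥ ∑ l ∈ Finset.Ioc j i, α l.castSucc)) •
        f.1 (j.castSucc.removeNth
          (Function.update v i.succ (π ![v j.castSucc, v i.succ]))) := by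
  let w : Fin (p + 1) → HVec 𝒱 := fun i => ⟨α i, v i, hv i⟩
  have h := congrFun (toHCochain_diff hπ f) w
  rw [cobd_eq_explicitCobd, explicitCobd] at h
  refine h.trans (congrArg₂ (· + ·) rfl ?_)
  refine Finset.sum_congr rfl fun i _ => Finset.sum_congr rfl fun j _ => ?_
  rw [toHCochain, removeNth_update_br]

/-- The coboundary operator of a Loday bracket on `M(V)`. -/
def differential (hπ : IsLodayBracket 𝒱 π) : Cochains 𝒱 →ₗ[K] Cochains 𝒱 :=
  DirectSum.toModule K (Deg n × ℕ) (Cochains 𝒱) fun x =>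
    DirectSum.lof K _ (fun x : Deg n × ℕ => weightMaps 𝒱 x.1 x.2) (x.1, x.2 + 1) ∘ₗ
      diff hπ x.1 x.2

theorem differential_lof (hπ : IsLodayBracket 𝒱 π) (B : Deg n) (p : ℕ) (f : weightMaps 𝒱 B p) :
    differential hπ (DirectSum.lof K _ (fun x : Deg n × ℕ => weightMaps 𝒱 x.1 x.2) (B, p) f) =
      DirectSum.lof K _ (fun x : Deg n × ℕ => weightMaps 𝒱 x.1 x.2) (B, p + 1)
        (diff hπ B p f) := by
  rw [differential, DirectSum.toModule_lof]
  rfl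

theorem differential_lof_apply (hπ : IsLodayBracket 𝒱 π) (B : Deg n) (p : ℕ)
    (f : weightMaps 𝒱 B p) :
    differential hπ (DirectSum.lof K _ (fun x : Deg n × ℕ => weightMaps 𝒱 x.1 x.2) (B, p) f)
      (B, p + 1) = diff hπ B p f := by
  rw [differential_lof, DirectSum.lof_apply]

theorem differential_comp_differential (hπ : IsLodayBracket 𝒱 π) :
    differential hπ ∘ₗ differential hπ = 0 := by
  refine DirectSum.linearMap_ext K fun x => LinearMap.ext fun f => ?_
  obtain ⟨B, p⟩ := x
  simp only [LinearMap.comp_apply, LinearMap.zero_apply]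
  rw [differential_lof hπ B p f, differential_lof hπ B (p + 1), diff_diff, map_zero]

/-- With i shifted by one, the triangle j ≤ i becomes the set of pairs j < i, as in the classical
formula. -/
theorem sum_Iic_comm {M : Type*} [AddCommMonoid M] {p : ℕ} (T : Fin p → Fin (p + 1) → M) :
    ∑ i : Fin p, ∑ j ∈ Finset.Iic i, T j i.succ =
      ∑ j : Fin p, ∑ i ∈ Finset.Ioi j.castSucc, T j i := by
  have e : ∀ j : Fin p, ∑ i ∈ Finset.Ioi j.castSucc, T j i =
      ∑ i : Fin p, if j ≤ i then T j i.succ else 0 := fun j => by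
    have h : Finset.Ioi j.castSucc = Finset.univ.filter (fun i => j.castSucc < i) := by ext; simp
    rw [h, Finset.sum_filter, Fin.sum_univ_succ]
    simp [Fin.castSucc_lt_succ_iff]
  simp only [e, sum_Iic_eq_ite]
  exact Finset.sum_comm

theorem diff_apply_of_nongraded (hπ : IsLodayBracket 𝒱 π) (h0 : 𝒱 0 = ⊤) {B : Deg n} {p : ℕ}
    (f : weightMaps 𝒱 B p) (v : Fin (p + 1) → V) :
    (diff hπ B p f).1 v = -lodayCoboundary π f.1 v := by
  -- All arguments have degree 0, so the weight `B` enters only through ⟨B, 0⟩ and every Koszul sign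
  -- is trivial.
  rw [diff_apply hπ f (α := 0) (fun i => by simp [h0]), lodayCoboundary,
    Fin.sum_univ_castSucc (n := p) (f := fun i => ∑ j ∈ Finset.Ioi i, _)]
  have e : Finset.Ioi (Fin.last p) = ∅ := by ext; simp [Fin.le_last]
  have h := sum_Iic_comm fun (j : Fin p) i => sgn (j.val : ℤ) •
    f.1 (j.castSucc.removeNth (Function.update v i (π ![v j.castSucc, v i])))
  simp only [Pi.zero_apply, dotProduct_zero, Finset.sum_const_zero, sgn_zero, mul_one, h, e,
    Finset.sum_empty, add_zero, sgn_add, sgn_one, mul_neg, neg_smul, Finset.sum_neg_distrib,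
    Fin.val_castSucc]
  abel

end Differential

/-! ### Comparison with the Chevalley–Eilenberg coboundary -/

section ChevalleyEilenberg

variable {K V : Type*} [Field K] [AddCommGroup V] [Module K V] {n : ℕ}
  {𝒱 : Deg n → Submodule K V} {π : MultilinearMap K (fun _ : Fin 2 => V) V}

/-- The k-th argument moves to the front by k adjacent transpositions: within the tail by induction,
then past the first argument. -/
theorem HSkew.apply_eq_cons : ∀ {m : ℕ} {F : HCochain 𝒱 (m + 1)}, HSkew F →
    ∀ (k : Fin (m + 1)) (w : Fin (m + 1) → HVec 𝒱),
      F w = (sgn (k.val : ℤ) * sgn ((w k).deg ⬝ᵥ ∑ l ∈ Finset.Iio k, (w l).deg)) •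
        F (Fin.cons (w k) (k.removeNth w)) := by
  intro m
  induction m with
  | zero =>
    intro F _ k w
    obtain rfl : k = 0 := Fin.ext (by omega)
    have e : Finset.Iio (0 : Fin 1) = ∅ := by ext; simp
    rw [e]
    simp only [Fin.val_zero, Nat.cast_zero, sgn_zero, Finset.sum_empty, dotProduct_zero, mul_one,
      one_smul]
    congr 1
    funext s
    obtain rfl : s = 0 := Fin.ext (by omega)
    rfl
  | succ m ih =>
    intro F hF k w
    refine Fin.consCases (fun x u => ?_) w
    induction k using Fin.cases with
    | zero =>
      have e : Finset.Iio (0 : Fin (m + 2)) = ∅ := by ext; simp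
      rw [e, removeNth_zero_cons]
      simp
    | succ k =>
      have h := ih (hF.2 x) k u
      change F (Fin.cons x u) = _ • F (Fin.cons x (Fin.cons (u k) (k.removeNth u))) at h
      rw [h, hF.1 (u k) x, removeNth_succ_cons, sum_Iio_succ]
      simp only [Fin.cons_zero, Fin.cons_succ, sgn_dotProduct_add_right, Fin.val_succ,
        Nat.cast_add, Nat.cast_one, sgn_add, sgn_one]
      module

theorem sum_Iio_succ_erase {M : Type*} [AddCommMonoid M] {b : ℕ} {i j : Fin (b + 1)}
    (hj : j ≤ i) (g : Fin (b + 2) → M) : ∑ l ∈ (Finset.Iio i.succ).erase j.castSucc, g l =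
      ∑ s, if s < i then g (j.castSucc.succAbove s) else 0 := by
  have h := sum_ite_succAbove j.castSucc (fun l => l ≠ j.castSucc ∧ l < i.succ)
    (fun h => h.1 rfl) g
  simp only [succAbove_castSucc_lt_succ hj, ne_eq, Fin.succAbove_ne, not_false_iff, true_and] at h
  rw [← h, ← Finset.sum_filter]
  congr 1
  ext; simp

theorem succAbove_succAbove_comm {b : ℕ} {i j : Fin (b + 1)} (hj : j ≤ i) (s : Fin b) :
    j.castSucc.succAbove (i.succAbove s) = i.succ.succAbove (j.succAbove s) := by
  rw [Fin.le_def] at hj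
  simp only [Fin.succAbove, Fin.lt_def, Fin.ext_iff]
  split_ifs <;> simp_all <;> omega

/-- The second factor is the sign for moving the bracket to the front. Its pairings of `v_j` with
the vectors strictly between the two bracketed ones repeat those of the first factor and cancel. -/
theorem ce_sign {m : ℕ} (α : Fin (m + 2) → Deg n) {i j : Fin (m + 1)} (hj : j ≤ i) :
    (sgn (j.val : ℤ) * sgn (α j.castSucc ⬝ᵥ ∑ l ∈ Finset.Ioc j i, α l.castSucc)) *
      (sgn (i.val : ℤ) * sgn ((α j.castSucc + α i.succ) ⬝ᵥ
        ∑ s, if s < i then α (j.castSucc.succAbove s) else 0)) =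
      -sgn ((j.val : ℤ) + i.val + 1 +
        α j.castSucc ⬝ᵥ (∑ l ∈ Finset.Iio j.castSucc, α l) +
        α i.succ ⬝ᵥ (∑ l ∈ (Finset.Iio i.succ).erase j.castSucc, α l)) := by
  have e : (∑ s : Fin (m + 1), if s < i then α (j.castSucc.succAbove s) else 0) =
      (∑ s, if s < j then α (j.castSucc.succAbove s) else 0) +
      ∑ s, if ¬ s < j ∧ s < i then α (j.castSucc.succAbove s) else 0 := by
    rw [← Finset.sum_add_distrib]
    refine Finset.sum_congr rfl fun s _ => ?_
    by_cases h : s < j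
    · simp [h, h.trans_le hj]
    · simp [h]
  rw [sum_Iio_castSucc, sum_Iio_succ_erase hj, sum_Ioc_castSucc hj, sgn_dotProduct_add_left]
  have e' := congrArg (fun t => sgn (α j.castSucc ⬝ᵥ t)) e
  simp only [sgn_dotProduct_add_right] at e'
  simp only [sgn_add, e', sgn_one]
  rcases sgn_eq_or (α j.castSucc ⬝ᵥ
    ∑ s, if ¬ s < j ∧ s < i then α (j.castSucc.succAbove s) else 0) with h | h <;>
  · rw [h]; ring

/-- Skew-symmetry of π turns {f(…), v_last} into the missing last term of the single sum, and
skew-symmetry of `f` moves each inner bracket to the front. -/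
theorem explicitCobd_eq_neg_ceCoboundary (hπ : IsLodayBracket 𝒱 π) (hs : IsGradedSkew 𝒱 π)
    {B : Deg n} {p : ℕ} {f : MultilinearMap K (fun _ : Fin p => V) V} (hf : f ∈ weightMaps 𝒱 B p)
    (hk : IsGradedSkew 𝒱 f) (w : Fin (p + 1) → HVec 𝒱) :
    explicitCobd hπ B (toHCochain 𝒱 f) w =
      -ceCoboundary π B f (fun i => (w i).deg) (fun i => (w i).val) := by
  have hF := hSkew_toHCochain.2 hk
  have h1 : Finset.Iio (Fin.last p) = Finset.univ.map Fin.castSuccEmb := by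
    ext l
    simp only [Finset.mem_Iio, Finset.mem_map, Finset.mem_univ, true_and, Fin.coe_castSuccEmb]
    exact ⟨fun h => Fin.exists_castSucc_eq.2 h.ne, by rintro ⟨a, rfl⟩; exact Fin.castSucc_lt_last a⟩
  have hlast : π ![toHCochain 𝒱 f (Fin.init w), (w (Fin.last p)).val] =
      -(sgn ((w (Fin.last p)).deg ⬝ᵥ (B + ∑ l ∈ Finset.Iio (Fin.last p), (w l).deg)) •
        π ![(w (Fin.last p)).val, f ((Fin.last p).removeNth fun i => (w i).val)]) := by
    have h := hs.bracket_comm (w (Fin.last p))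
      ⟨B + ∑ i, (Fin.init w i).deg, toHCochain 𝒱 f (Fin.init w), mem_weightMaps_iff.1 hf _⟩
    rw [h1, Finset.sum_map]
    refine h.trans ?_
    rw [Fin.removeNth_last]
    rfl
  have hbr : (∑ i : Fin p, ∑ j ∈ Finset.Iic i, (sgn (j.val : ℤ) *
      sgn ((w j.castSucc).deg ⬝ᵥ ∑ l ∈ Finset.Ioc j i, (w l.castSucc).deg)) •
      toHCochain 𝒱 f (j.castSucc.removeNth
        (Function.update w i.succ ((w j.castSucc).br hπ (w i.succ))))) =
      -ceBracketPart π f (fun i => (w i).deg) (fun i => (w i).val) := by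
    cases p with
    | zero => simp [ceBracketPart]
    | succ m =>
      rw [ceBracketPart, ← Finset.sum_neg_distrib]
      refine Finset.sum_congr rfl fun i _ => ?_
      rw [← Finset.sum_neg_distrib]
      refine Finset.sum_congr rfl fun j hj => ?_
      have hj : j ≤ i := Finset.mem_Iic.1 hj
      have e1 : j.castSucc.succAbove i = i.succ := Fin.succAbove_castSucc_of_le _ _ hj
      rw [hF.apply_eq_cons i, smul_smul, ← neg_smul, ← ce_sign (fun i => (w i).deg) hj]
      have e2 : j.castSucc.removeNth
          (Function.update w i.succ ((w j.castSucc).br hπ (w i.succ))) i =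
          (w j.castSucc).br hπ (w i.succ) := by
        rw [Fin.removeNth, e1, Function.update_self]
      -- After removal of `j` the bracket sits in slot `i`, so the slots passed on the way to the
      -- front hold original vectors.
      have e3 : (∑ l ∈ Finset.Iio i, (j.castSucc.removeNth
          (Function.update w i.succ ((w j.castSucc).br hπ (w i.succ))) l).deg) =
          ∑ s, if s < i then (w (j.castSucc.succAbove s)).deg else 0 := by
        rw [sum_Iio_eq_ite]
        refine Finset.sum_congr rfl fun s _ => ?_
        split_ifs with h
        · rw [Fin.removeNth, Function.update_of_ne]
          rw [← e1]
          exact fun h' => h.ne (Fin.succAbove_right_injective h')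
        · rfl
      rw [e2, e3]
      refine congrArg₂ (· • ·) rfl (congrArg f ?_)
      funext s
      refine Fin.cases ?_ (fun s => ?_) s
      · rfl
      · simp only [Fin.cons_succ, Fin.removeNth]
        rw [Function.update_of_ne, succAbove_succAbove_comm hj]
        rw [← e1]
        exact fun h' => Fin.succAbove_ne i s (Fin.succAbove_right_injective h')
  rw [explicitCobd, ceCoboundary, hlast, hbr, Fin.sum_univ_castSucc]
  simp only [sgn_add, Fin.val_castSucc, Fin.val_last, dotProduct_comm (w _).deg]
  rw [smul_neg, smul_smul]
  simp only [neg_add_rev, sub_eq_add_neg]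
  have e : ∀ i : Fin p, i.castSucc.removeNth (fun i => (w i).val) =
      fun s => (i.castSucc.removeNth w s).val := fun _ => rfl
  simp only [e, toHCochain]
  abel

end ChevalleyEilenberg

/-- For a graded Lie bracket, the coboundary operator is, up to the sign, the graded
Chevalley–Eilenberg coboundary on graded skew-symmetric maps. -/
theorem diff_apply_of_skew {K V : Type*} [Field K] [AddCommGroup V] [Module K V] {n : ℕ}
    [NeZero n] {𝒱 : Deg n → Submodule K V} [DirectSum.Decomposition 𝒱]
    {π : MultilinearMap K (fun _ : Fin 2 => V) V} (hπ : IsLodayBracket 𝒱 π)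
    (hs : IsGradedSkew 𝒱 π) {B : Deg n} {p : ℕ} (f : weightMaps 𝒱 B p)
    (hk : IsGradedSkew 𝒱 f.1) {α : Fin (p + 1) → Deg n} {v : Fin (p + 1) → V}
    (hv : ∀ i, v i ∈ 𝒱 (α i)) : (diff hπ B p f).1 v = -ceCoboundary π B f.1 α v := by
  have h := congrFun (toHCochain_diff hπ f) fun i => ⟨α i, v i, hv i⟩
  rw [cobd_eq_explicitCobd, explicitCobd_eq_neg_ceCoboundary hπ hs f.2 hk] at h
  exact h

end GradedLoday

end

/-! ### The proposition -/

theorem mainTheorem10 {K V : Type*} [Field K] [CharZero K] [AddCommGroup V] [Module K V]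
    {n : ℕ} [NeZero n] (𝒱 : GradedLoday.Deg n → Submodule K V) [DirectSum.Decomposition 𝒱]
    (π : MultilinearMap K (fun _ : Fin 2 => V) V) (hπ : GradedLoday.IsLodayBracket 𝒱 π) :
    ∃ D : GradedLoday.Cochains 𝒱 →ₗ[K] GradedLoday.Cochains 𝒱,
      -- on `M^{(B,b)}(V)`, `b ≥ 0`, the operator is `[π, -]^⊗`, with values in `M^{(B,b+1)}(V)`
      (∀ (B : GradedLoday.Deg n) (b : ℕ) (f : GradedLoday.weightMaps 𝒱 B (b + 1)),
        ∃ h : GradedLoday.stemBracket 𝒱 0 B (a := 1) (b := b) π f ∈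
            GradedLoday.weightMaps 𝒱 B (b + 2),
          D (DirectSum.lof K _ (fun x : GradedLoday.Deg n × ℕ =>
              GradedLoday.weightMaps 𝒱 x.1 x.2) (B, b + 1) f) =
            DirectSum.lof K _ (fun x : GradedLoday.Deg n × ℕ =>
              GradedLoday.weightMaps 𝒱 x.1 x.2) (B, b + 2)
              ⟨GradedLoday.stemBracket 𝒱 0 B (a := 1) (b := b) π f, h⟩) ∧
      -- on `M^{(B,-1)}(V) = V^B`, it is `v ↦ {v, -}`, with values in `M^{(B,0)}(V)`
      (∀ (B : GradedLoday.Deg n) (f : GradedLoday.weightMaps 𝒱 B 0),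
        ∃ h : π.curryLeft (f.1 ![]) ∈ GradedLoday.weightMaps 𝒱 B 1,
          D (DirectSum.lof K _ (fun x : GradedLoday.Deg n × ℕ =>
              GradedLoday.weightMaps 𝒱 x.1 x.2) (B, 0) f) =
            DirectSum.lof K _ (fun x : GradedLoday.Deg n × ℕ =>
              GradedLoday.weightMaps 𝒱 x.1 x.2) (B, 1) ⟨π.curryLeft (f.1 ![]), h⟩) ∧
      -- the explicit formula, for `p = b + 1 ≥ 0` and homogeneous arguments
      (∀ (B : GradedLoday.Deg n) (p : ℕ) (f : GradedLoday.weightMaps 𝒱 B p)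
        (α : Fin (p + 1) → GradedLoday.Deg n) (v : Fin (p + 1) → V), (∀ i, v i ∈ 𝒱 (α i)) →
        (D (DirectSum.lof K _ (fun x : GradedLoday.Deg n × ℕ =>
            GradedLoday.weightMaps 𝒱 x.1 x.2) (B, p) f) (B, p + 1)).1 v =
          GradedLoday.sgn (p : ℤ) • π ![f.1 (Fin.init v), v (Fin.last p)] -
          (∑ i : Fin p, (GradedLoday.sgn (i.val : ℤ) *
            GradedLoday.sgn ((B + ∑ l ∈ Finset.Iio i.castSucc, α l) ⬝ᵥ α i.castSucc)) •
            π ![v i.castSucc, f.1 (i.castSucc.removeNth v)]) +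
          ∑ i : Fin p, ∑ j ∈ Finset.Iic i, (GradedLoday.sgn (j.val : ℤ) *
            GradedLoday.sgn (α j.castSucc ⬝ᵥ ∑ l ∈ Finset.Ioc j i, α l.castSucc)) •
            f.1 (j.castSucc.removeNth
              (Function.update v i.succ (π ![v j.castSucc, v i.succ])))) ∧
      -- it is a differential on all of `M(V)`
      D ∘ₗ D = 0 ∧
      -- the nongraded case
      (𝒱 0 = ⊤ → ∀ (B : GradedLoday.Deg n) (p : ℕ) (f : GradedLoday.weightMaps 𝒱 B p)
        (v : Fin (p + 1) → V),
        (D (DirectSum.lof K _ (fun x : GradedLoday.Deg n × ℕ =>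
            GradedLoday.weightMaps 𝒱 x.1 x.2) (B, p) f) (B, p + 1)).1 v =
          -GradedLoday.lodayCoboundary π f.1 v) ∧
      -- the antisymmetric case
      (GradedLoday.IsGradedSkew 𝒱 π →
        ∀ (B : GradedLoday.Deg n) (p : ℕ) (f : GradedLoday.weightMaps 𝒱 B p),
          GradedLoday.IsGradedSkew 𝒱 f.1 →
          GradedLoday.IsGradedSkew 𝒱 (D (DirectSum.lof K _ (fun x : GradedLoday.Deg n × ℕ =>
            GradedLoday.weightMaps 𝒱 x.1 x.2) (B, p) f) (B, p + 1)).1 ∧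
          ∀ (α : Fin (p + 1) → GradedLoday.Deg n) (v : Fin (p + 1) → V),
            (∀ i, v i ∈ 𝒱 (α i)) →
            (D (DirectSum.lof K _ (fun x : GradedLoday.Deg n × ℕ =>
              GradedLoday.weightMaps 𝒱 x.1 x.2) (B, p) f) (B, p + 1)).1 v =
              -GradedLoday.ceCoboundary π B f.1 α v) := by
  refine ⟨GradedLoday.differential hπ, fun B b f => ?_, fun B f => ?_, fun B p f α v hv => ?_,
    GradedLoday.differential_comp_differential hπ, fun h0 B p f v => ?_, fun hs B p f hk => ?_⟩
  -- `diffFun` reduces by definition to the stem bracket here and to v ↦ {v, -} in arity 0, so the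
  -- same two lemmas serve both cases.
  · exact ⟨GradedLoday.diffFun_mem hπ f.2, GradedLoday.differential_lof hπ B (b + 1) f⟩
  · exact ⟨GradedLoday.diffFun_mem hπ f.2, GradedLoday.differential_lof hπ B 0 f⟩
  · rw [GradedLoday.differential_lof_apply]
    exact GradedLoday.diff_apply hπ f hv
  · rw [GradedLoday.differential_lof_apply]
    exact GradedLoday.diff_apply_of_nongraded hπ h0 f v
  · rw [GradedLoday.differential_lof_apply]
    refine ⟨?_, fun α v hv => GradedLoday.diff_apply_of_skew hπ hs f hk hv⟩
    rw [← GradedLoday.hSkew_toHCochain, GradedLoday.toHCochain_diff]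
    exact GradedLoday.hSkew_cobd hπ hs (GradedLoday.isCochain_toHCochain f.2)
      (GradedLoday.hSkew_toHCochain.2 hk)
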